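/- Let $p:A\to M$ be a Lie algebroid over a smooth manifold $M$, i.e. a smooth real vector bundle of finite rank with a Lie bracket $[\cdot,\cdot]$ on its space $\Gamma(A)$ of smooth sections and a bundle map $\#:A\to TM$ which induces a Lie algebra homomorphism $\Gamma(A)\to\mathfrak X(M)$ and satisfies $[a,fb]=f[a,b]+\#(a)(f)\,b$ for $a,b\in\Gamma(A)$, $f\in C^\infty(M)$. Let $\langle\cdot,\cdot\rangle$ be a Riemannian metric on $A$, i.e. a smooth family of scalar products on the fibers of $A$. * A linear $A$-connection is a biadditive map $\mathcal D:\Gamma(A)\times\Gamma(A)\to\Gamma(A)$ with $\mathcal D_{fa}b=f\mathcal D_ab$ and $\mathcal D_a(fb)=f\mathcal D_ab+\#(a)(f)\,b$. It is a Levi-Civita $A$-connection if moreover $\#(a)\langle b,c\rangle=\langle\mathcal D_ab,c\rangle+\langle b,\mathcal D_ac\rangle$ and $\mathcal D_ab-\mathcal D_ba=[a,b]$. * Let $S\subset\mathbb R$ be an interval with more than one point. An $A$-path on $S$ is a smooth curve $\alpha:S\to A$ with $\#(\alpha(t))=\frac{d}{dt}p(\alpha(t))$. For a curve $s:S\to A$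 over the base path $\gamma=p\circ\alpha$, written near $t$ as $s(u)=\sum_k f_k(u)\,b_k(\gamma(u))$ with $f_k$ smooth and $b_k\in\Gamma(A)$, its covariant derivative along $\alpha$ is $(\mathcal D^\alpha s)(t)=\sum_k \big(f_k'(t)\,b_k(\gamma(t))+f_k(t)\,\mathcal D_{\alpha(t)}b_k\big)$. The $A$-path $\alpha$ is a geodesic of $\mathcal D$ if $\mathcal D^\alpha\alpha=0$. * The dual bundle $q:A^*\to M$ carries the linear Poisson structure, i.e. the unique Poisson bracket on $C^\infty(A^*)$ with $\{\ell_a,\ell_b\}=\ell_{[a,b]}$, $\{\ell_a,f\circ q\}=\#(a)(f)\circ q$ and $\{f\circ q,g\circ q\}=0$ for $a,b\in\Gamma(A)$ and $f,g\in C^\infty(M)$, where $\ell_a(\mu)=\langle\mu,a(q(\mu))\rangle$. Transport it to a Poisson bracket $\{\cdot,\cdot\}$ on $C^\infty(A)$ through the bundle isomorphism $A\to A^*$, $a\mapsto\langle a,\cdot\rangle$. * Let $E:A\to\mathbb R$, $E(a)=\frac12\langle a,a\rangle$. A Hamiltonian vector field of $E$ is a smooth vector field $X_E$ on $A$ with $X_E(h)=\{E,h\}$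 for every $h\in C^\infty(A)$. **Theorem.** There is exactly one Levi-Civita $A$-connection $\mathcal D$ of $\langle\cdot,\cdot\rangle$, there is exactly one Hamiltonian vector field $X_E$ of $E$, and for every interval $S\subset\mathbb R$ with more than one point, a curve $\alpha:S\to A$ is a geodesic of $\mathcal D$ if and only if it is an integral curve of $X_E$ (i.e. $\alpha$ is differentiable with $\dot\alpha(t)=X_E(\alpha(t))$ for all $t\in S$). -/

import Mathlib

open Bundle Manifold Set Filter Topology
open scoped ContDiff

noncomputable section

set_option linter.unusedSectionVars false

namespace RiemLieAlgebroid

section Basic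

variable {E : Type*} [NormedAddCommGroup E] [NormedSpace ℝ E] [FiniteDimensional ℝ E]
  {M : Type*} [TopologicalSpace M] [ChartedSpace E M] [IsManifold 𝓘(ℝ, E) ∞ M] [T2Space M]
  {F : Type*} [NormedAddCommGroup F] [NormedSpace ℝ F]
  {V : M → Type*} [TopologicalSpace (TotalSpace F V)] [∀ x, AddCommGroup (V x)]
  [∀ x, Module ℝ (V x)] [∀ x, TopologicalSpace (V x)] [FiberBundle F V] [VectorBundle ℝ F V]
  [ContMDiffVectorBundle ∞ F V 𝓘(ℝ, E)]

variable (E F V) in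
/-- Smooth global sections `Γ(V)` of a smooth vector bundle `V → M`. -/
abbrev Sec : Type _ := Cₛ^∞⟮𝓘(ℝ, E); F, V⟯

/-- The derivative at `x` of a real function `f` in the direction of a tangent vector `X`. -/
def dirDeriv (f : M → ℝ) (x : M) (X : TangentSpace 𝓘(ℝ, E) x) : ℝ :=
  mfderiv 𝓘(ℝ, E) 𝓘(ℝ, ℝ) f x X

/-- The product `f s` of a smooth function and a smooth section. -/
def smulSec (f : C^∞⟮𝓘(ℝ, E), M; 𝓘(ℝ, ℝ), ℝ⟯) (s : Sec E F V) : Sec E F V :=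
  ⟨fun x => f x • s x, f.contMDiff.smul_section s.contMDiff⟩

variable (E) in
/-- Every vector of a smooth vector bundle is the value of a smooth global section. -/
theorem exists_section_through (v : TotalSpace F V) : ∃ s : Sec E F V, s v.proj = v.2 := by
  obtain ⟨u, hu, hs⟩ := FiberBundle.exists_contMDiffOn_extend (k := ∞) 𝓘(ℝ, E) F v.2
  obtain ⟨ψ, -, hψ⟩ := (SmoothBumpFunction.nhds_basis_tsupport (I := 𝓘(ℝ, E)) v.proj).mem_iff.1
    (interior_mem_nhds.2 hu)
  refine ⟨⟨fun x => ψ x • FiberBundle.extend F v.2 x, ?_⟩, ?_⟩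
  · exact ContMDiffOn.smul_section_of_tsupport ψ.contMDiff.contMDiffOn isOpen_interior hψ
      (hs.mono interior_subset)
  · change ψ v.proj • FiberBundle.extend F v.2 v.proj = v.2
    rw [ψ.eq_one, one_smul, FiberBundle.extend_apply_self]

variable (E) in
/-- A chosen smooth global section through a given vector. It is used only in expressions whose
value does not depend on the choice. -/
def sectionThrough (v : TotalSpace F V) : Sec E F V := (exists_section_through E v).choose

theorem sectionThrough_apply (v : TotalSpace F V) : sectionThrough E v v.proj = v.2 :=
  (exists_section_through E v).choose_spec

end Basic

section Algebroid

variable (E : Type*) [NormedAddCommGroup E] [NormedSpace ℝ E] [FiniteDimensional ℝ E]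
  {M : Type*} [TopologicalSpace M] [ChartedSpace E M] [IsManifold 𝓘(ℝ, E) ∞ M] [T2Space M]
  (F : Type*) [NormedAddCommGroup F] [NormedSpace ℝ F]
  (A : M → Type*) [TopologicalSpace (TotalSpace F A)] [∀ x, AddCommGroup (A x)]
  [∀ x, Module ℝ (A x)] [∀ x, TopologicalSpace (A x)] [FiberBundle F A] [VectorBundle ℝ F A]
  [ContMDiffVectorBundle ∞ F A 𝓘(ℝ, E)]

/-- A Lie algebroid structure on the vector bundle `A → M`. -/
structure LieAlgebroid where
  /-- the anchor `# : A → TM` -/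
  anchor : ∀ x, A x →L[ℝ] TangentSpace 𝓘(ℝ, E) x
  contMDiff_anchor : ContMDiff (𝓘(ℝ, E).prod 𝓘(ℝ, F)) 𝓘(ℝ, E).tangent ∞
    (fun v : TotalSpace F A => (⟨v.proj, anchor v.proj v.2⟩ : TangentBundle 𝓘(ℝ, E) M))
  /-- the Lie bracket on `Γ(A)` -/
  bracket : Sec E F A →ₗ[ℝ] Sec E F A →ₗ[ℝ] Sec E F A
  bracket_self : ∀ a, bracket a a = 0
  jacobi : ∀ a b c,
    bracket a (bracket b c) + bracket b (bracket c a) + bracket c (bracket a b) = 0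
  /-- the anchor is a homomorphism of Lie algebras from `Γ(A)` to vector fields -/
  anchor_bracket : ∀ a b x, anchor x (bracket a b x) =
    VectorField.mlieBracket 𝓘(ℝ, E) (fun y => anchor y (a y)) (fun y => anchor y (b y)) x
  /-- the Leibniz identity `[a, f b] = f [a, b] + #(a)(f) b` -/
  leibniz : ∀ (a b : Sec E F A) (f : C^∞⟮𝓘(ℝ, E), M; 𝓘(ℝ, ℝ), ℝ⟯) (x : M),
    bracket a (smulSec f b) x =
      f x • bracket a b x + dirDeriv f x (anchor x (a x)) • b x

variable {E F A}

/-- The derivative `#(a)(f)` of a function along the anchor of a section. -/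
def LieAlgebroid.deriv (L : LieAlgebroid E F A) (a : Sec E F A) (f : M → ℝ) (x : M) : ℝ :=
  dirDeriv f x (L.anchor x (a x))

/-- A linear `A`-connection: an `A`-connection on the vector bundle `A` itself. -/
@[ext]
structure LinearConnection (L : LieAlgebroid E F A) where
  toFun : Sec E F A → Sec E F A → Sec E F A
  add_left : ∀ a b s, toFun (a + b) s = toFun a s + toFun b s
  add_right : ∀ a s₁ s₂, toFun a (s₁ + s₂) = toFun a s₁ + toFun a s₂
  smul_left : ∀ f a s, toFun (smulSec f a) s = smulSec f (toFun a s)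
  leibniz : ∀ (f : C^∞⟮𝓘(ℝ, E), M; 𝓘(ℝ, ℝ), ℝ⟯) (a s : Sec E F A) (x : M),
    toFun a (smulSec f s) x = f x • toFun a s x + L.deriv a f x • s x

/-- `D_v b` for a vector `v` of `A`; since `D` is `C^∞(M)`-linear in its first argument, any section
through `v` may be used. -/
def LinearConnection.at {L : LieAlgebroid E F A} (D : LinearConnection L) (v : TotalSpace F A)
    (b : Sec E F A) : A v.proj :=
  D.toFun (sectionThrough E v) b v.proj

/-- `α` is an `A`-path on the interval `S`: it is smooth and `#(α) = d(p ∘ α)/dt`. -/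
def IsAPathOn (L : LieAlgebroid E F A) (α : ℝ → TotalSpace F A) (S : Set ℝ) : Prop :=
  ContMDiffOn 𝓘(ℝ, ℝ) (𝓘(ℝ, E).prod 𝓘(ℝ, F)) ∞ α S ∧
  ∀ t ∈ S, HasMFDerivWithinAt 𝓘(ℝ, ℝ) 𝓘(ℝ, E) (fun u => (α u).proj) S t
    ((1 : ℝ →L[ℝ] ℝ).smulRight (L.anchor (α t).proj (α t).2))

/-- `w` is the covariant derivative `(D^α s)(t)` of the `α`-section `s`: if
`s(u) = ∑ k, f k (u) • b k (γ u)` for `u` near `t`, where `γ = p ∘ α` and the `b k` are smooth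
sections, then `(D^α s)(t) = ∑ k, (f k)'(t) • b k (γ t) + f k (t) • D_{α(t)} (b k)`. -/
def HasCovDerivAlong {L : LieAlgebroid E F A} (D : LinearConnection L) (S : Set ℝ)
    (α s : ℝ → TotalSpace F A) (t : ℝ) (w : A (α t).proj) : Prop :=
  ∃ (n : ℕ) (f : Fin n → ℝ → ℝ) (b : Fin n → Sec E F A),
    (∀ k, ContDiffWithinAt ℝ ∞ (f k) S t) ∧
    (∀ᶠ u in 𝓝[S] t, s u = ⟨(α u).proj, ∑ k, f k u • b k (α u).proj⟩) ∧
    w = ∑ k, (derivWithin (f k) S t • b k (α t).proj + f k t • D.at (α t) (b k))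

/-- Geodesics of `D` on the interval `S`: the `A`-paths `α` with `D^α α = 0`. -/
def IsGeodesicOn {L : LieAlgebroid E F A} (D : LinearConnection L) (α : ℝ → TotalSpace F A)
    (S : Set ℝ) : Prop :=
  IsAPathOn L α S ∧ ∀ t ∈ S, HasCovDerivAlong D S α α t 0

end Algebroid

section Dual

variable {E : Type*} [NormedAddCommGroup E] [NormedSpace ℝ E] [FiniteDimensional ℝ E]
  {M : Type*} [TopologicalSpace M] [ChartedSpace E M] [IsManifold 𝓘(ℝ, E) ∞ M] [T2Space M]
  {F : Type*} [NormedAddCommGroup F] [NormedSpace ℝ F] [FiniteDimensional ℝ F]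
  {A : M → Type*} [TopologicalSpace (TotalSpace F A)] [∀ x, AddCommGroup (A x)]
  [∀ x, Module ℝ (A x)] [∀ x, TopologicalSpace (A x)] [FiberBundle F A] [VectorBundle ℝ F A]
  [ContMDiffVectorBundle ∞ F A 𝓘(ℝ, E)]
  [∀ x, IsTopologicalAddGroup (A x)] [∀ x, ContinuousSMul ℝ (A x)]

variable (F A) in
/-- The total space of the dual bundle `A*`. -/
abbrev DualSpace : Type _ := TotalSpace (F →L[ℝ] ℝ) (fun x => A x →L[ℝ] Trivial M ℝ x)

variable (E F A) in
/-- Smooth sections `Γ(A*)` of the dual bundle. -/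
abbrev DualSec : Type _ := Sec E (F →L[ℝ] ℝ) (fun x => A x →L[ℝ] Trivial M ℝ x)

theorem exists_fiberDeriv {f : DualSpace F A → ℝ}
    (hf : ContMDiff (𝓘(ℝ, E).prod 𝓘(ℝ, F →L[ℝ] ℝ)) 𝓘(ℝ, ℝ) ∞ f) (μ : DualSpace F A) :
    ∃ v : A μ.proj, ∀ ν : A μ.proj →L[ℝ] ℝ,
      HasDerivAt (fun t : ℝ => f ⟨μ.proj, μ.2 + t • ν⟩) (ν v) 0 := by
  let T := trivializationAt F A μ.proj
  have hm : μ.proj ∈ T.baseSet := FiberBundle.mem_baseSet_trivializationAt' μ.proj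
  let e : A μ.proj ≃L[ℝ] F := T.continuousLinearEquivAt ℝ μ.proj hm
  let j : (F →L[ℝ] ℝ) → DualSpace F A := fun φ => ⟨μ.proj, φ.comp (T.continuousLinearMapAt ℝ μ.proj)⟩
  have hj : ContMDiff 𝓘(ℝ, F →L[ℝ] ℝ) (𝓘(ℝ, E).prod 𝓘(ℝ, F →L[ℝ] ℝ)) ∞ j := by
    intro φ₀
    rw [contMDiffAt_hom_bundle]
    refine ⟨contMDiffAt_const, contMDiffAt_id.congr_of_eventuallyEq (Eventually.of_forall ?_)⟩
    intro φ
    ext w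
    simp [j, ContinuousLinearMap.inCoordinates, T.continuousLinearMapAt_symmL hm, T]
  have hg : ContDiff ℝ ∞ (f ∘ j) := (hf.comp hj).contDiff
  let φ₀ : F →L[ℝ] ℝ := μ.2.comp (T.symmL ℝ μ.proj)
  let d := fderiv ℝ (f ∘ j) φ₀
  let b := Module.finBasis ℝ F
  let c : Fin (Module.finrank ℝ F) → (F →L[ℝ] ℝ) := fun i => LinearMap.toContinuousLinearMap (b.coord i)
  refine ⟨T.symmL ℝ μ.proj (∑ i, d (c i) • b i), fun ν => ?_⟩
  let φ : F →L[ℝ] ℝ := ν.comp (T.symmL ℝ μ.proj)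
  have hφ : φ = ∑ i, φ (b i) • c i := by
    apply ContinuousLinearMap.coe_injective
    refine b.ext fun k => ?_
    simp [c, Finsupp.single_apply]
  have h1 : d φ = ν (T.symmL ℝ μ.proj (∑ i, d (c i) • b i)) := by
    conv_lhs => rw [hφ]
    simp only [map_sum, map_smul, smul_eq_mul, φ, ContinuousLinearMap.comp_apply]
    exact Finset.sum_congr rfl fun i _ => mul_comm _ _
  rw [← h1]
  have h2 : HasDerivAt (fun t : ℝ => φ₀ + t • φ) φ 0 := by
    simpa using ((hasDerivAt_id (0 : ℝ)).smul_const φ).const_add φ₀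
  have h3 : HasFDerivAt (f ∘ j) d (φ₀ + (0 : ℝ) • φ) := by
    simpa using (hg.differentiable (by simp) φ₀).hasFDerivAt
  refine (h3.comp_hasDerivAt (0 : ℝ) h2).congr_of_eventuallyEq (Eventually.of_forall fun t => ?_)
  change f _ = f _
  congr 1
  simp only [j]
  congr 1
  ext w
  have hw : T.symmL ℝ μ.proj (T.continuousLinearMapAt ℝ μ.proj w) = w :=
    T.symmL_continuousLinearMapAt hm w
  change μ.2 w + t • ν w = (μ.2 (T.symmL ℝ μ.proj (T.continuousLinearMapAt ℝ μ.proj w)) +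
    t • ν (T.symmL ℝ μ.proj (T.continuousLinearMapAt ℝ μ.proj w)) : ℝ)
  rw [hw]

/-- The fiberwise differential of `f` at `μ ∈ (A_x)*`, as an element of `A_x = (A_x)**`: the vector
`v` with `⟨ν, v⟩ = d/dt f(μ + t ν)` at `t = 0`, for all `ν ∈ (A_x)*`. -/
def fiberDeriv (f : DualSpace F A → ℝ) (μ : DualSpace F A) : A μ.proj :=
  Classical.epsilon fun v : A μ.proj => ∀ ν : A μ.proj →L[ℝ] ℝ,
    HasDerivAt (fun t : ℝ => f ⟨μ.proj, μ.2 + t • ν⟩) (ν v) 0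

theorem fiberDeriv_spec {f : DualSpace F A → ℝ}
    (hf : ContMDiff (𝓘(ℝ, E).prod 𝓘(ℝ, F →L[ℝ] ℝ)) 𝓘(ℝ, ℝ) ∞ f) (μ : DualSpace F A)
    (ν : A μ.proj →L[ℝ] ℝ) :
    HasDerivAt (fun t : ℝ => f ⟨μ.proj, μ.2 + t • ν⟩) (ν (fiberDeriv f μ)) 0 :=
  Classical.epsilon_spec (exists_fiberDeriv hf μ) ν

/-- The canonical (linear) Poisson bracket of smooth functions on `A*`. At `μ ∈ (A_x)*`, it is
`⟨ξ, [a, b]⟩ + #(a)(g ∘ ξ - ⟨ξ, b⟩) - #(b)(f ∘ ξ - ⟨ξ, a⟩)`, evaluated at `x`,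
where `ξ ∈ Γ(A*)` passes through `μ` and `a, b ∈ Γ(A)` pass through the fiberwise differentials of
`f, g` at `μ`; equivalently `#(a)(g ∘ ξ) - #(b)(f ∘ ξ) - (d_A ξ)(a, b)`, where `d_A` is the Lie
algebroid differential. The value does not depend on the choice of `ξ, a, b`. The bracket is the
biderivation such that, for the fiberwise linear functions `ℓ_a(μ) = ⟨μ, a⟩` and the functions
`f ∘ p` pulled back from `M`,
`{ℓ_a, ℓ_b} = ℓ_[a,b]`, `{ℓ_a, f ∘ p} = #(a)(f) ∘ p` and `{f ∘ p, g ∘ p} = 0`. -/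
def dualBracket (L : LieAlgebroid E F A) (f g : DualSpace F A → ℝ) (μ : DualSpace F A) : ℝ :=
  let ξ : DualSec E F A := sectionThrough E μ
  let a : Sec E F A := sectionThrough E ⟨μ.proj, fiberDeriv f μ⟩
  let b : Sec E F A := sectionThrough E ⟨μ.proj, fiberDeriv g μ⟩
  ξ μ.proj (L.bracket a b μ.proj)
    + L.deriv a (fun x => g ⟨x, ξ x⟩ - ξ x (b x)) μ.proj
    - L.deriv b (fun x => f ⟨x, ξ x⟩ - ξ x (a x)) μ.proj

variable (E F A) in
/-- A Riemannian metric on `A`: a smooth family of scalar products on the fibers. -/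
abbrev Metric : Type _ := ContMDiffRiemannianMetric 𝓘(ℝ, E) ∞ F A

theorem flat_bijective (g : Metric E F A) (x : M) : Function.Bijective (g.inner x) := by
  have hi : Function.Injective (g.inner x).toLinearMap := by
    rw [← LinearMap.ker_eq_bot, LinearMap.ker_eq_bot']
    intro v hv
    by_contra h
    have h1 := g.pos x v h
    have h2 : g.inner x v v = 0 := by
      have : g.inner x v = 0 := hv
      rw [this]; rfl
    linarith
  let e : A x ≃L[ℝ] F :=
    (trivializationAt F A x).continuousLinearEquivAt ℝ x (FiberBundle.mem_baseSet_trivializationAt' x)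
  let e' : (A x →L[ℝ] ℝ) ≃ₗ[ℝ] (F →L[ℝ] ℝ) :=
    (e.arrowCongr (ContinuousLinearEquiv.refl ℝ ℝ)).toLinearEquiv
  have := e.toLinearEquiv.symm.finiteDimensional
  have := e'.symm.finiteDimensional
  have hd : Module.finrank ℝ (A x) = Module.finrank ℝ (A x →L[ℝ] ℝ) := by
    rw [e.toLinearEquiv.finrank_eq, e'.finrank_eq,
      ← (LinearMap.toContinuousLinearMap (𝕜 := ℝ) (E := F) (F' := ℝ)).finrank_eq]
    exact (Subspace.dual_finrank_eq (K := ℝ) (V := F)).symm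
  exact ⟨hi, (LinearMap.injective_iff_surjective_of_finrank_eq_finrank hd).1 hi⟩

/-- The bundle isomorphism `A → A*`, `a ↦ ⟨a, ·⟩`, defined by the metric. -/
def musical (g : Metric E F A) : TotalSpace F A ≃ DualSpace F A where
  toFun a := ⟨a.proj, g.inner a.proj a.2⟩
  invFun μ := ⟨μ.proj, (Equiv.ofBijective _ (flat_bijective g μ.proj)).symm μ.2⟩
  left_inv a := congrArg (TotalSpace.mk a.proj)
    ((Equiv.ofBijective _ (flat_bijective g a.proj)).symm_apply_apply a.2)
  right_inv μ := congrArg (TotalSpace.mk μ.proj)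
    ((Equiv.ofBijective _ (flat_bijective g μ.proj)).apply_symm_apply μ.2)

/-- The Poisson bracket on `A` obtained by transporting the one of `A*` through `A ≃ A*`. -/
def metricBracket (L : LieAlgebroid E F A) (g : Metric E F A) (f h : TotalSpace F A → ℝ)
    (a : TotalSpace F A) : ℝ :=
  dualBracket L (f ∘ (musical g).symm) (h ∘ (musical g).symm) (musical g a)

/-- The energy `a ↦ ⟨a, a⟩ / 2`. -/
def energy (g : Metric E F A) (a : TotalSpace F A) : ℝ := (1 / 2) * g.inner a.proj a.2 a.2

/-- `X` is the Hamiltonian vector field of `f` on `A`: a smooth vector field such that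
`X(h) = {f, h}` for every smooth function `h` on `A`. -/
def IsHamiltonianVectorField (L : LieAlgebroid E F A) (g : Metric E F A) (f : TotalSpace F A → ℝ)
    (X : ∀ a : TotalSpace F A, TangentSpace (𝓘(ℝ, E).prod 𝓘(ℝ, F)) a) : Prop :=
  ContMDiff (𝓘(ℝ, E).prod 𝓘(ℝ, F)) (𝓘(ℝ, E).prod 𝓘(ℝ, F)).tangent ∞
    (fun a => (⟨a, X a⟩ : TangentBundle (𝓘(ℝ, E).prod 𝓘(ℝ, F)) (TotalSpace F A))) ∧
  ∀ h : TotalSpace F A → ℝ, ContMDiff (𝓘(ℝ, E).prod 𝓘(ℝ, F)) 𝓘(ℝ, ℝ) ∞ h →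
    ∀ a, (mfderiv (𝓘(ℝ, E).prod 𝓘(ℝ, F)) 𝓘(ℝ, ℝ) h a (X a) : ℝ) = metricBracket L g f h a

/-- `D` is the Levi-Civita `A`-connection of the metric: it is metric and torsion free. -/
structure IsLeviCivita {L : LieAlgebroid E F A} (g : Metric E F A) (D : LinearConnection L) :
    Prop where
  metric : ∀ (a b c : Sec E F A) (x : M), L.deriv a (fun y => g.inner y (b y) (c y)) x =
    g.inner x (D.toFun a b x) (c x) + g.inner x (b x) (D.toFun a c x)
  torsion_free : ∀ a b : Sec E F A, D.toFun a b - D.toFun b a = L.bracket a b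

end Dual

end RiemLieAlgebroid

end

/-!
The argument rests on testing everything on the fibrewise affine functions `f ∘ p + ⟨·, c⟩` on `A`,
for `f ∈ C^∞(M)` and `c ∈ Γ(A)`. They contain local coordinates of `A`
(`containsCoordinates_affineFun`), so tangent vectors are determined by their action on them, and
the smoothness of vector fields and the velocity of curves can be checked on them.

The Levi-Civita connection is given by the Koszul formula: its right-hand side is `C^∞(M)`-linear in
the last argument, hence is the pairing with a smooth section (`exists_riesz`, proved with a local
frame and its dual frame), and every metric torsion-free connection satisfies the formula.

For the Hamiltonian vector field, let `s` be a section through `a`, let `h` be a smooth function on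
`A`, and let `w` be the fibre gradient of `h` at `a`. Writing the bracket of `A*` with a metric and
torsion-free connection `D`, all terms with derivatives of the auxiliary sections cancel, except in
`{E, h}(a) = d(h ∘ s)(#a) - ⟨D_a s, w⟩` (`exists_metricBracket_energy`). The right-hand side is
the derivative of `h` along the horizontal lift `ds(#a) - (D_a s)^vert` of `#a`, so this lift is the
value of the Hamiltonian field, and on affine functions it gives
`X_E(f ∘ p + ⟨·, c⟩)(a) = df(#a) + ⟨a, D_a c⟩` (`metricBracket_energy_affineFun`), which is smooth
in `a`.

Along a curve `α` whose base path has velocity `#α`, the connection being metric gives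
`⟨α, c⟩' = ⟨D^α α, c⟩ + ⟨α, D_α c⟩` (`hasDerivWithinAt_pairing`). Comparing with the previous
formula, `α' = X_E(α)` holds exactly when `α` is over its anchor and `D^α α = 0`; the
smoothness that the notion of geodesic requires follows by bootstrapping from the differential equation.
-/

set_option linter.unusedSectionVars false

/-! ### Global extensions of local smooth data -/

namespace RiemLieAlgebroid

section Extension

variable {E : Type*} [NormedAddCommGroup E] [NormedSpace ℝ E] [FiniteDimensional ℝ E]
  {M : Type*} [TopologicalSpace M] [ChartedSpace E M] [IsManifold 𝓘(ℝ, E) ∞ M] [T2Space M]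
  {F : Type*} [NormedAddCommGroup F] [NormedSpace ℝ F]
  {V : M → Type*} [TopologicalSpace (TotalSpace F V)] [∀ x, AddCommGroup (V x)]
  [∀ x, Module ℝ (V x)] [∀ x, TopologicalSpace (V x)] [FiberBundle F V] [VectorBundle ℝ F V]
  [ContMDiffVectorBundle ∞ F V 𝓘(ℝ, E)]

theorem exists_smooth_bump {x₀ : M} {U : Set M} (hU : U ∈ 𝓝 x₀) :
    ∃ ρ : C^∞⟮𝓘(ℝ, E), M; 𝓘(ℝ, ℝ), ℝ⟯, tsupport ρ ⊆ U ∧ ⇑ρ =ᶠ[𝓝 x₀] 1 := by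
  obtain ⟨ψ, -, hψ⟩ :=
    (SmoothBumpFunction.nhds_basis_tsupport (I := 𝓘(ℝ, E)) x₀).mem_iff.1 hU
  exact ⟨⟨ψ, ψ.contMDiff⟩, hψ, ψ.eventuallyEq_one⟩

/-- The germ of a smooth local section extends to a global section. -/
theorem exists_sec_eventuallyEq {s : ∀ x, V x} {x₀ : M}
    (hs : ∀ᶠ x in 𝓝 x₀, ContMDiffAt 𝓘(ℝ, E) (𝓘(ℝ, E).prod 𝓘(ℝ, F)) ∞
      (fun y => TotalSpace.mk' F y (s y)) x) :
    ∃ t : Sec E F V, ∀ᶠ x in 𝓝 x₀, t x = s x := by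
  obtain ⟨U, hU, hUo, hx₀⟩ := eventually_nhds_iff.1 hs
  obtain ⟨ρ, hρ, hρ1⟩ := exists_smooth_bump (E := E) (hUo.mem_nhds hx₀)
  refine ⟨⟨fun x => ρ x • s x, ContMDiffOn.smul_section_of_tsupport ρ.contMDiff.contMDiffOn
    hUo hρ fun x hx => (hU x hx).contMDiffWithinAt⟩, ?_⟩
  filter_upwards [hρ1] with x hx
  change ρ x • s x = s x
  rw [hx, Pi.one_apply, one_smul]

/-- The germ of a smooth local function extends to a global smooth function. -/
theorem exists_smooth_eventuallyEq {f : M → ℝ} {x₀ : M}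
    (hf : ∀ᶠ x in 𝓝 x₀, ContMDiffAt 𝓘(ℝ, E) 𝓘(ℝ, ℝ) ∞ f x) :
    ∃ h : C^∞⟮𝓘(ℝ, E), M; 𝓘(ℝ, ℝ), ℝ⟯, ⇑h =ᶠ[𝓝 x₀] f := by
  obtain ⟨U, hU, hUo, hx₀⟩ := eventually_nhds_iff.1 hf
  obtain ⟨ρ, hρ, hρ1⟩ := exists_smooth_bump (E := E) (hUo.mem_nhds hx₀)
  refine ⟨⟨fun x => ρ x • f x, contMDiff_of_tsupport fun x hx => ?_⟩, ?_⟩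
  · exact ρ.contMDiff.contMDiffAt.smul (hU x (hρ (tsupport_smul_subset_left _ _ hx)))
  · filter_upwards [hρ1] with x hx
    change ρ x • f x = f x
    rw [hx, Pi.one_apply, one_smul]

theorem contMDiffAt_det {N : Type*} [TopologicalSpace N] [ChartedSpace E N]
    {ι : Type*} [Fintype ι] [DecidableEq ι]
    {G : N → Matrix ι ι ℝ} {x₀ : N}
    (hG : ∀ i j, ContMDiffAt 𝓘(ℝ, E) 𝓘(ℝ, ℝ) ∞ (fun x => G x i j) x₀) :
    ContMDiffAt 𝓘(ℝ, E) 𝓘(ℝ, ℝ) ∞ (fun x => (G x).det) x₀ := by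
  simp only [Matrix.det_apply, Units.smul_def, zsmul_eq_mul]
  exact ContMDiffAt.sum fun σ _ => contMDiffAt_const.mul (contMDiffAt_finsetProd fun i _ => hG _ _)

theorem contMDiffAt_matrix_inv {ι : Type*} [Fintype ι] [DecidableEq ι]
    {G : M → Matrix ι ι ℝ} {x₀ : M}
    (hG : ∀ i j, ContMDiffAt 𝓘(ℝ, E) 𝓘(ℝ, ℝ) ∞ (fun x => G x i j) x₀) (h : (G x₀).det ≠ 0)
    (i j : ι) : ContMDiffAt 𝓘(ℝ, E) 𝓘(ℝ, ℝ) ∞ (fun x => (G x)⁻¹ i j) x₀ := by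
  simp only [Matrix.inv_def, Matrix.smul_apply, Matrix.adjugate_apply, Ring.inverse_eq_inv',
    smul_eq_mul]
  refine ((contMDiffAt_det hG).inv₀ h).mul (contMDiffAt_det fun k l => ?_)
  by_cases hk : k = j
  · subst hk
    simpa using contMDiffAt_const
  · simpa [Matrix.updateRow_ne hk] using hG k l

end Extension

/-! ### Dual frames and Riesz representation of tensorial forms -/

section Metric

variable {E : Type*} [NormedAddCommGroup E] [NormedSpace ℝ E] [FiniteDimensional ℝ E]
  {M : Type*} [TopologicalSpace M] [ChartedSpace E M] [IsManifold 𝓘(ℝ, E) ∞ M] [T2Space M]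
  {F : Type*} [NormedAddCommGroup F] [NormedSpace ℝ F] [FiniteDimensional ℝ F]
  {A : M → Type*} [TopologicalSpace (TotalSpace F A)] [∀ x, AddCommGroup (A x)]
  [∀ x, Module ℝ (A x)] [∀ x, TopologicalSpace (A x)] [FiberBundle F A] [VectorBundle ℝ F A]
  [ContMDiffVectorBundle ∞ F A 𝓘(ℝ, E)]
  [∀ x, IsTopologicalAddGroup (A x)] [∀ x, ContinuousSMul ℝ (A x)]
  (g : Metric E F A)

theorem contMDiff_inner {EN : Type*} [NormedAddCommGroup EN] [NormedSpace ℝ EN]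
    {HN : Type*} [TopologicalSpace HN] {J : ModelWithCorners ℝ EN HN}
    {N : Type*} [TopologicalSpace N] [ChartedSpace HN N]
    {b : N → M} {v w : ∀ y, A (b y)}
    (hv : ContMDiff J (𝓘(ℝ, E).prod 𝓘(ℝ, F)) ∞ (fun y => TotalSpace.mk' F (b y) (v y)))
    (hw : ContMDiff J (𝓘(ℝ, E).prod 𝓘(ℝ, F)) ∞ (fun y => TotalSpace.mk' F (b y) (w y))) :
    ContMDiff J 𝓘(ℝ, ℝ) ∞ (fun y => g.inner (b y) (v y) (w y)) := by
  have hb : ContMDiff J 𝓘(ℝ, E) ∞ b := fun y => (contMDiffAt_totalSpace.1 (hv y)).1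
  have : ContMDiff J (𝓘(ℝ, E).prod 𝓘(ℝ, ℝ)) ∞
      (fun y => TotalSpace.mk' ℝ (E := Bundle.Trivial M ℝ) (b y) (g.inner (b y) (v y) (w y))) :=
    ContMDiff.clm_bundle_apply₂ (F₁ := F) (F₂ := F) (g.contMDiff.comp hb) hv hw
  exact fun y => (contMDiffAt_totalSpace.1 (this y)).2

/-- The fibrewise linear function `v ↦ ⟨v, c⟩` on `A` defined by a section `c`; it corresponds to
`ℓ_c` under the isomorphism `A ≃ A*`. -/
noncomputable def pairing (c : Sec E F A) (v : TotalSpace F A) : ℝ := g.inner v.proj v.2 (c v.proj)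

theorem contMDiff_pairing (c : Sec E F A) :
    ContMDiff (𝓘(ℝ, E).prod 𝓘(ℝ, F)) 𝓘(ℝ, ℝ) ∞ (pairing g c) :=
  contMDiff_inner g (b := TotalSpace.proj) (v := fun v => v.2) contMDiff_id
    (c.contMDiff.comp (contMDiff_proj A))

/-- The smooth function `⟨s, t⟩` on `M` defined by two sections. -/
noncomputable def innerFun (s t : Sec E F A) : C^∞⟮𝓘(ℝ, E), M; 𝓘(ℝ, ℝ), ℝ⟯ :=
  ⟨fun x => g.inner x (s x) (t x), contMDiff_inner g (b := id) s.contMDiff t.contMDiff⟩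

@[simp]
theorem innerFun_apply (s t : Sec E F A) (x : M) : innerFun g s t x = g.inner x (s x) (t x) := rfl

theorem innerFun_comm (b c : Sec E F A) : innerFun g b c = innerFun g c b := by
  ext x
  exact g.symm x _ _

theorem contMDiff_energy :
    ContMDiff (𝓘(ℝ, E).prod 𝓘(ℝ, F)) 𝓘(ℝ, ℝ) ∞ (energy g) :=
  contMDiff_const.mul (contMDiff_inner g (b := TotalSpace.proj) (v := fun v => v.2)
    (w := fun v => v.2) contMDiff_id contMDiff_id)

theorem inner_ext {x : M} {v w : A x} (h : ∀ u, g.inner x v u = g.inner x w u) : v = w :=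
  (flat_bijective g x).1 (ContinuousLinearMap.ext h)

theorem inner_ext_sec {x : M} {v w : A x}
    (h : ∀ c : Sec E F A, g.inner x v (c x) = g.inner x w (c x)) : v = w :=
  inner_ext g fun u => by
    have := h (sectionThrough E ⟨x, u⟩)
    rwa [sectionThrough_apply (E := E) (⟨x, u⟩ : TotalSpace F A)] at this

/-- Near each point there are a local frame `e` and its `g`-dual frame `e'`, both made of global
sections, and `e` may be taken constant in the preferred trivialization. The dual frame is obtained
from the inverse of the Gram matrix of `e`. -/
theorem exists_dual_frames (x₀ : M) :
    ∃ e e' : Fin (Module.finrank ℝ F) → Sec E F A, ∀ᶠ x in 𝓝 x₀, ∀ v : A x,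
      v = ∑ i, g.inner x v (e' i x) • e i x ∧
      (trivializationAt F A x₀ ⟨x, v⟩).2 =
        ∑ i, g.inner x v (e' i x) • Module.finBasis ℝ F i := by
  let T := trivializationAt F A x₀
  have hx₀ : x₀ ∈ T.baseSet := FiberBundle.mem_baseSet_trivializationAt' x₀
  let b := Module.finBasis ℝ F
  have hT : ∀ᶠ x in 𝓝 x₀, x ∈ T.baseSet := T.open_baseSet.mem_nhds hx₀
  have h1 (i) : ∃ t : Sec E F A, ∀ᶠ x in 𝓝 x₀, t x = T.localFrame b i x :=
    exists_sec_eventuallyEq (hT.mono fun x hx =>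
      contMDiffAt_localFrame_of_mem (I := 𝓘(ℝ, E)) ∞ T b i hx)
  choose e he using h1
  have he' : ∀ᶠ x in 𝓝 x₀, ∀ v : A x, v = ∑ i, b.repr (T ⟨x, v⟩).2 i • e i x := by
    filter_upwards [hT, eventually_all.2 he] with x hx hex v
    simp only [hex, T.localFrame_apply_of_mem_baseSet b hx]
    conv_lhs => rw [← (T.basisAt b hx).sum_repr v]
    rfl
  let G : M → Matrix (Fin (Module.finrank ℝ F)) (Fin (Module.finrank ℝ F)) ℝ :=
    fun x => Matrix.of fun i j => g.inner x (e i x) (e j x)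
  have hG (x) (i j) : ContMDiffAt 𝓘(ℝ, E) 𝓘(ℝ, ℝ) ∞ (fun x => G x i j) x :=
    (innerFun g (e i) (e j)).contMDiff x
  have hdet : (G x₀).det ≠ 0 := by
    intro h0
    obtain ⟨w, hw0, hw⟩ := Matrix.exists_mulVec_eq_zero_iff.2 h0
    -- a vector in the kernel of the Gram matrix is orthogonal to the frame, hence zero
    have hv : ∑ j, w j • e j x₀ = 0 := by
      refine inner_ext g fun u => ?_
      have h2 (i) : g.inner x₀ (∑ j, w j • e j x₀) (e i x₀) = 0 := by
        rw [← Pi.zero_apply (M := fun _ => ℝ) i, ← hw]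
        simp only [map_sum, map_smul, _root_.sum_apply, _root_.smul_apply, smul_eq_mul,
          Matrix.mulVec, dotProduct, G, Matrix.of_apply]
        exact Finset.sum_congr rfl fun j _ => by rw [mul_comm, g.symm]
      rw [map_zero, _root_.zero_apply, he'.self_of_nhds u, map_sum]
      exact Finset.sum_eq_zero fun i _ => by rw [map_smul, h2, smul_zero]
    apply hw0
    have h3 : ∑ j, w j • T.basisAt b hx₀ j = 0 := by
      rw [← hv]
      refine Finset.sum_congr rfl fun j _ => ?_
      rw [(he j).self_of_nhds, T.localFrame_apply_of_mem_baseSet b hx₀]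
    exact funext (Fintype.linearIndependent_iff.1 (T.basisAt b hx₀).linearIndependent w h3)
  have hdet' : ∀ᶠ x in 𝓝 x₀, (G x).det ≠ 0 :=
    (contMDiffAt_det (hG x₀)).continuousAt.eventually_ne hdet
  have h4 (i) : ∃ t : Sec E F A, ∀ᶠ x in 𝓝 x₀, t x = ∑ j, (G x)⁻¹ i j • e j x := by
    refine exists_sec_eventuallyEq (hdet'.mono fun x hx => ?_)
    exact ContMDiffAt.sum_section fun j _ =>
      (contMDiffAt_matrix_inv (hG x) hx i j).smul_section (e j).contMDiff.contMDiffAt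
  choose e' h5 using h4
  refine ⟨e, e', ?_⟩
  filter_upwards [he', hdet', eventually_all.2 h5] with x hx hdx h5x v
  have h6 (i) : g.inner x v (e' i x) = b.repr (T ⟨x, v⟩).2 i := by
    conv_lhs => rw [h5x, hx v]
    have h7 (k) : ∑ j, (G x)⁻¹ i j * g.inner x (e k x) (e j x) = if i = k then 1 else 0 := by
      have := congrFun (congrFun (Matrix.nonsing_inv_mul (G x) (isUnit_iff_ne_zero.2 hdx)) i) k
      rw [Matrix.one_apply] at this
      rw [← this, Matrix.mul_apply]
      exact Finset.sum_congr rfl fun j _ => by rw [g.symm]; rfl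
    simp only [map_sum, map_smul, _root_.sum_apply, _root_.smul_apply,
        smul_eq_mul, Finset.mul_sum]
    rw [Finset.sum_comm]
    simp only [mul_left_comm _ (b.repr _ _), ← Finset.mul_sum, h7]
    simp
  refine ⟨?_, ?_⟩
  · simp only [h6]; exact hx v
  · simp only [h6]; exact (b.sum_repr _).symm

/-- A map into `A` is smooth as soon as its base map and its pairings with sections are. -/
theorem contMDiffWithinAt_of_pairing {EN : Type*} [NormedAddCommGroup EN] [NormedSpace ℝ EN]
    {HN : Type*} [TopologicalSpace HN] {J : ModelWithCorners ℝ EN HN}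
    {N : Type*} [TopologicalSpace N] [ChartedSpace HN N] {n : ℕ∞ω} {Φ : N → TotalSpace F A}
    {S : Set N} {y : N}
    (h1 : ContMDiffWithinAt J 𝓘(ℝ, E) n (fun z => (Φ z).proj) S y)
    (h2 : ∀ c : Sec E F A, ContMDiffWithinAt J 𝓘(ℝ, ℝ) n (fun z => pairing g c (Φ z)) S y) :
    ContMDiffWithinAt J (𝓘(ℝ, E).prod 𝓘(ℝ, F)) n Φ S y := by
  refine contMDiffWithinAt_totalSpace.2 ⟨h1, ?_⟩
  obtain ⟨e, e', he⟩ := exists_dual_frames g (Φ y).proj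
  have h3 : ContMDiffWithinAt J 𝓘(ℝ, F) n
      (fun z => ∑ i, pairing g (e' i) (Φ z) • Module.finBasis ℝ F i) S y :=
    ContMDiffWithinAt.sum fun i _ => (h2 (e' i)).smul contMDiffWithinAt_const
  refine h3.congr_of_eventuallyEq ?_ (he.self_of_nhds (Φ y).2).2
  exact (h1.continuousWithinAt.eventually he).mono fun z hz => (hz (Φ z).2).2

/-- A `C^∞(M)`-linear operation on sections is computed in a local frame. -/
theorem tensorial_eq_sum {x : M} {T : Sec E F A → ℝ} (hadd : ∀ s t, T (s + t) = T s + T t)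
    (hsmul : ∀ f s, T (smulSec f s) = f x * T s) {ι : Type*} [Fintype ι] {e e' : ι → Sec E F A}
    (he : ∀ᶠ y in 𝓝 x, ∀ v : A y, v = ∑ i, g.inner y v (e' i y) • e i y) (c : Sec E F A) :
    T c = ∑ i, g.inner x (c x) (e' i x) * T (e i) := by
  obtain ⟨ρ, hρ, hρ1⟩ := exists_smooth_bump (E := E) he
  -- the frame expansion is only local, so it is multiplied by a bump function equal to `1` at `x`
  have h1 : smulSec ρ c = ∑ i, smulSec (ρ * innerFun g c (e' i)) (e i) := by
    ext y
    have h0 := congrFun (map_sum (ContMDiffSection.coeAddHom 𝓘(ℝ, E) F ∞ A)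
      (fun i => smulSec (ρ * innerFun g c (e' i)) (e i)) Finset.univ) y
    rw [Finset.sum_apply] at h0
    refine Eq.trans ?_ h0.symm
    change ρ y • c y = ∑ i, (ρ y * g.inner y (c y) (e' i y)) • e i y
    by_cases hy : ρ y = 0
    · simp [hy]
    · have := hρ (subset_tsupport _ hy) (c y)
      conv_lhs => rw [this]
      simp only [mul_smul, Finset.smul_sum]
  have h2 : T (smulSec ρ c) = T c := by
    rw [hsmul, hρ1.self_of_nhds, Pi.one_apply, one_mul]
  rw [← h2, h1]
  have h3 := map_sum (AddMonoidHom.mk' T hadd) (fun i => smulSec (ρ * innerFun g c (e' i)) (e i))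
    Finset.univ
  simp only [AddMonoidHom.mk'_apply] at h3
  rw [h3]
  refine Finset.sum_congr rfl fun i _ => ?_
  rw [hsmul]
  change ρ x * g.inner x (c x) (e' i x) * _ = _
  rw [hρ1.self_of_nhds, Pi.one_apply, one_mul]

/-- A `C^∞(M)`-linear operation on sections only depends on the value of the section at the
point. -/
theorem tensorial_congr (g : Metric E F A) {x : M} {T : Sec E F A → ℝ}
    (hadd : ∀ s t, T (s + t) = T s + T t)
    (hsmul : ∀ f s, T (smulSec f s) = f x * T s) {s t : Sec E F A} (h : s x = t x) : T s = T t := by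
  obtain ⟨e, e', he⟩ := exists_dual_frames g x
  have he' := he.mono fun y hy v => (hy v).1
  rw [tensorial_eq_sum g hadd hsmul he', tensorial_eq_sum g hadd hsmul he', h]

/-- Smooth Riesz representation: every `C^∞(M)`-linear form on `Γ(A)` is `⟨d, ·⟩` for a smooth
section `d`. -/
theorem exists_riesz (T : Sec E F A → M → ℝ)
    (hT : ∀ c, ContMDiff 𝓘(ℝ, E) 𝓘(ℝ, ℝ) ∞ (T c))
    (hadd : ∀ s t x, T (s + t) x = T s x + T t x)
    (hsmul : ∀ (f : C^∞⟮𝓘(ℝ, E), M; 𝓘(ℝ, ℝ), ℝ⟯) s x, T (smulSec f s) x = f x * T s x) :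
    ∃ d : Sec E F A, ∀ c x, g.inner x (d x) (c x) = T c x := by
  have key (x₀ : M) : ∃ e e' : Fin (Module.finrank ℝ F) → Sec E F A, ∀ᶠ x in 𝓝 x₀,
      ∀ c : Sec E F A, g.inner x (∑ i, T (e' i) x • e i x) (c x) = T c x := by
    obtain ⟨e, e', he⟩ := exists_dual_frames g x₀
    refine ⟨e, e', ?_⟩
    filter_upwards [eventually_eventually_nhds.2 he] with x hx c
    -- duality of frames is symmetric
    have hd : ∀ᶠ y in 𝓝 x, ∀ v : A y, v = ∑ i, g.inner y v (e i y) • e' i y := by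
      filter_upwards [hx] with y hy v
      refine inner_ext g fun u => ?_
      conv_lhs => rw [(hy u).1]
      simp only [map_sum, map_smul, _root_.sum_apply, _root_.smul_apply, smul_eq_mul]
      exact Finset.sum_congr rfl fun i _ => by rw [mul_comm, g.symm y u]
    rw [tensorial_eq_sum g (T := fun c => T c x) (fun s t => hadd s t x)
      (fun f s => hsmul f s x) hd c]
    simp only [map_sum, map_smul, _root_.sum_apply, _root_.smul_apply, smul_eq_mul]
    exact Finset.sum_congr rfl fun i _ => by rw [mul_comm, g.symm]
  have hex (x : M) : ∃ v : A x, ∀ c : Sec E F A, g.inner x v (c x) = T c x := by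
    obtain ⟨e, e', h⟩ := key x
    exact ⟨_, h.self_of_nhds⟩
  choose d hd using hex
  refine ⟨⟨d, fun x₀ => ?_⟩, fun c x => hd x c⟩
  obtain ⟨e, e', h⟩ := key x₀
  have h1 : ContMDiffAt 𝓘(ℝ, E) (𝓘(ℝ, E).prod 𝓘(ℝ, F)) ∞
      (fun x => TotalSpace.mk' F x (∑ i, T (e' i) x • e i x)) x₀ :=
    ContMDiffAt.sum_section fun i _ =>
      (hT (e' i)).contMDiffAt.smul_section (e i).contMDiff.contMDiffAt
  refine h1.congr_of_eventuallyEq (h.mono fun x hx => ?_)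
  change TotalSpace.mk' F x (d x) = _
  congr 1
  exact inner_ext_sec (E := E) g fun c => by rw [hd, hx]

end Metric

/-! ### The Koszul formula and the Levi-Civita connection -/

section LeviCivita

variable {E : Type*} [NormedAddCommGroup E] [NormedSpace ℝ E] [FiniteDimensional ℝ E]
  {M : Type*} [TopologicalSpace M] [ChartedSpace E M] [IsManifold 𝓘(ℝ, E) ∞ M] [T2Space M]
  {F : Type*} [NormedAddCommGroup F] [NormedSpace ℝ F] [FiniteDimensional ℝ F]
  {A : M → Type*} [TopologicalSpace (TotalSpace F A)] [∀ x, AddCommGroup (A x)]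
  [∀ x, Module ℝ (A x)] [∀ x, TopologicalSpace (A x)] [FiberBundle F A] [VectorBundle ℝ F A]
  [ContMDiffVectorBundle ∞ F A 𝓘(ℝ, E)]
  [∀ x, IsTopologicalAddGroup (A x)] [∀ x, ContinuousSMul ℝ (A x)]

theorem dirDeriv_add {f h : M → ℝ} (hf : ContMDiff 𝓘(ℝ, E) 𝓘(ℝ, ℝ) ∞ f)
    (hh : ContMDiff 𝓘(ℝ, E) 𝓘(ℝ, ℝ) ∞ h) (x : M) (X : TangentSpace 𝓘(ℝ, E) x) :
    dirDeriv (fun y => f y + h y) x X = dirDeriv f x X + dirDeriv h x X := by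
  have h1 := (hf.mdifferentiable (by simp) x).hasMFDerivAt.add
    (hh.mdifferentiable (by simp) x).hasMFDerivAt
  exact congrArg (fun φ => φ X) h1.mfderiv

theorem dirDeriv_mul {f h : M → ℝ} (hf : ContMDiff 𝓘(ℝ, E) 𝓘(ℝ, ℝ) ∞ f)
    (hh : ContMDiff 𝓘(ℝ, E) 𝓘(ℝ, ℝ) ∞ h) (x : M) (X : TangentSpace 𝓘(ℝ, E) x) :
    dirDeriv (fun y => f y * h y) x X = f x * dirDeriv h x X + h x * dirDeriv f x X := by
  have h1 := (hf.mdifferentiable (by simp) x).hasMFDerivAt.mul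
    (hh.mdifferentiable (by simp) x).hasMFDerivAt
  exact congrArg (fun φ => φ X) h1.mfderiv

theorem smulSec_apply (f : C^∞⟮𝓘(ℝ, E), M; 𝓘(ℝ, ℝ), ℝ⟯) (a : Sec E F A) (x : M) :
    smulSec f a x = f x • a x := rfl

namespace LieAlgebroid

variable (L : LieAlgebroid E F A)

/-- The function `v ↦ df(#v)` on `A` is smooth. -/
theorem contMDiff_dirDeriv_anchor {f : M → ℝ} (hf : ContMDiff 𝓘(ℝ, E) 𝓘(ℝ, ℝ) ∞ f) :
    ContMDiff (𝓘(ℝ, E).prod 𝓘(ℝ, F)) 𝓘(ℝ, ℝ) ∞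
      (fun v : TotalSpace F A => dirDeriv f v.proj (L.anchor v.proj v.2)) :=
  (contMDiff_snd_tangentBundle_modelSpace ℝ 𝓘(ℝ, ℝ)).comp
    ((hf.contMDiff_tangentMap (m := ∞) (by simp)).comp L.contMDiff_anchor)

theorem contMDiff_deriv (a : Sec E F A) {f : M → ℝ} (hf : ContMDiff 𝓘(ℝ, E) 𝓘(ℝ, ℝ) ∞ f) :
    ContMDiff 𝓘(ℝ, E) 𝓘(ℝ, ℝ) ∞ (L.deriv a f) :=
  (L.contMDiff_dirDeriv_anchor hf).comp a.contMDiff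

theorem deriv_add_left (a b : Sec E F A) (f : M → ℝ) (x : M) :
    L.deriv (a + b) f x = L.deriv a f x + L.deriv b f x := by
  rw [LieAlgebroid.deriv, ContMDiffSection.coe_add, Pi.add_apply, map_add]
  exact map_add (mfderiv 𝓘(ℝ, E) 𝓘(ℝ, ℝ) f x) _ _

theorem deriv_smulSec (f : C^∞⟮𝓘(ℝ, E), M; 𝓘(ℝ, ℝ), ℝ⟯) (a : Sec E F A) (h : M → ℝ) (x : M) :
    L.deriv (smulSec f a) h x = f x * L.deriv a h x := by
  rw [LieAlgebroid.deriv, smulSec_apply, map_smul]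
  exact map_smul (mfderiv 𝓘(ℝ, E) 𝓘(ℝ, ℝ) h x) _ _

theorem bracket_skew (a b : Sec E F A) : L.bracket a b = -L.bracket b a := by
  have h := L.bracket_self (a + b)
  simp only [map_add, LinearMap.add_apply, L.bracket_self, add_zero, zero_add] at h
  exact eq_neg_of_add_eq_zero_right h

theorem bracket_smulSec_left (f : C^∞⟮𝓘(ℝ, E), M; 𝓘(ℝ, ℝ), ℝ⟯) (a b : Sec E F A) (x : M) :
    L.bracket (smulSec f a) b x = f x • L.bracket a b x - L.deriv b f x • a x := by
  rw [L.bracket_skew, L.bracket_skew a b]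
  change -(L.bracket b (smulSec f a) x) = f x • -(L.bracket b a x) - _
  rw [L.leibniz, smul_neg, neg_add, ← sub_eq_add_neg]
  rfl

variable (g : Metric E F A)

theorem deriv_inner_add (a b b' c : Sec E F A) (x : M) :
    L.deriv a (innerFun g (b + b') c) x =
      L.deriv a (innerFun g b c) x + L.deriv a (innerFun g b' c) x := by
  rw [LieAlgebroid.deriv, LieAlgebroid.deriv, LieAlgebroid.deriv,
    ← dirDeriv_add (innerFun g b c).contMDiff (innerFun g b' c).contMDiff]
  congr 1
  ext y
  simp

theorem deriv_inner_smul (a b c : Sec E F A) (f : C^∞⟮𝓘(ℝ, E), M; 𝓘(ℝ, ℝ), ℝ⟯) (x : M) :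
    L.deriv a (innerFun g (smulSec f b) c) x =
      f x * L.deriv a (innerFun g b c) x + L.deriv a f x * g.inner x (b x) (c x) := by
  rw [LieAlgebroid.deriv, LieAlgebroid.deriv, LieAlgebroid.deriv,
    mul_comm (dirDeriv f x _), ← innerFun_apply,
    ← dirDeriv_mul f.contMDiff (innerFun g b c).contMDiff]
  congr 1
  ext y
  simp [smulSec]

/-- The right-hand side of the Koszul formula: the Levi-Civita connection is determined by
`⟨D_a b, c⟩ = koszul a b c`. -/
noncomputable def koszul (a b c : Sec E F A) (x : M) : ℝ :=
  (1 / 2) * (L.deriv a (innerFun g b c) x + L.deriv b (innerFun g a c) x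
    - L.deriv c (innerFun g a b) x + g.inner x (L.bracket a b x) (c x)
    - g.inner x (L.bracket b c x) (a x) - g.inner x (L.bracket a c x) (b x))

theorem contMDiff_koszul (a b c : Sec E F A) :
    ContMDiff 𝓘(ℝ, E) 𝓘(ℝ, ℝ) ∞ (L.koszul g a b c) :=
  contMDiff_const.mul ((((((L.contMDiff_deriv a (innerFun g b c).contMDiff).add
    (L.contMDiff_deriv b (innerFun g a c).contMDiff)).sub
    (L.contMDiff_deriv c (innerFun g a b).contMDiff)).add
    (innerFun g (L.bracket a b) c).contMDiff).sub
    (innerFun g (L.bracket b c) a).contMDiff).sub (innerFun g (L.bracket a c) b).contMDiff)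

theorem koszul_add_left (a a' b c : Sec E F A) (x : M) :
    L.koszul g (a + a') b c x = L.koszul g a b c x + L.koszul g a' b c x := by
  simp only [koszul, deriv_add_left, deriv_inner_add, map_add, LinearMap.add_apply,
    ContMDiffSection.coe_add, Pi.add_apply, _root_.add_apply]
  ring

theorem koszul_add_mid (a b b' c : Sec E F A) (x : M) :
    L.koszul g a (b + b') c x = L.koszul g a b c x + L.koszul g a b' c x := by
  simp only [koszul, deriv_add_left, deriv_inner_add, map_add, LinearMap.add_apply,
    ContMDiffSection.coe_add, Pi.add_apply, _root_.add_apply, innerFun_comm g a]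
  ring

theorem koszul_add_right (a b c c' : Sec E F A) (x : M) :
    L.koszul g a b (c + c') x = L.koszul g a b c x + L.koszul g a b c' x := by
  simp only [koszul, deriv_add_left, innerFun_comm g _ (c + c'), deriv_inner_add, map_add,
    ContMDiffSection.coe_add, Pi.add_apply, _root_.add_apply, innerFun_comm g c,
    innerFun_comm g c']
  ring

theorem bracket_smulSec_right (f : C^∞⟮𝓘(ℝ, E), M; 𝓘(ℝ, ℝ), ℝ⟯) (a b : Sec E F A) (x : M) :
    L.bracket a (smulSec f b) x = f x • L.bracket a b x + L.deriv a f x • b x :=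
  L.leibniz a b f x

theorem koszul_smul_left (f : C^∞⟮𝓘(ℝ, E), M; 𝓘(ℝ, ℝ), ℝ⟯) (a b c : Sec E F A) (x : M) :
    L.koszul g (smulSec f a) b c x = f x * L.koszul g a b c x := by
  simp only [koszul, deriv_smulSec, deriv_inner_smul, bracket_smulSec_left, smulSec_apply,
    map_sub, map_smul, _root_.sub_apply, _root_.smul_apply, smul_eq_mul]
  rw [g.symm x (a x) (b x)]
  ring

theorem koszul_smul_mid (f : C^∞⟮𝓘(ℝ, E), M; 𝓘(ℝ, ℝ), ℝ⟯) (a b c : Sec E F A) (x : M) :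
    L.koszul g a (smulSec f b) c x =
      f x * L.koszul g a b c x + L.deriv a f x * g.inner x (b x) (c x) := by
  simp only [koszul, deriv_smulSec, innerFun_comm g a (smulSec f b), deriv_inner_smul,
    bracket_smulSec_left, bracket_smulSec_right, smulSec_apply, innerFun_comm g b a,
    map_add, map_sub, map_smul, _root_.add_apply, _root_.sub_apply, _root_.smul_apply, smul_eq_mul]
  ring

theorem koszul_smul_right (f : C^∞⟮𝓘(ℝ, E), M; 𝓘(ℝ, ℝ), ℝ⟯) (a b c : Sec E F A) (x : M) :
    L.koszul g a b (smulSec f c) x = f x * L.koszul g a b c x := by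
  simp only [koszul, deriv_smulSec, innerFun_comm g _ (smulSec f c), deriv_inner_smul,
    bracket_smulSec_right, smulSec_apply, innerFun_comm g c,
    map_add, map_smul, _root_.add_apply, _root_.smul_apply, smul_eq_mul]
  rw [g.symm x (c x) (a x), g.symm x (c x) (b x)]
  ring

theorem exists_koszul (a b : Sec E F A) :
    ∃ d : Sec E F A, ∀ c x, g.inner x (d x) (c x) = L.koszul g a b c x :=
  exists_riesz g (L.koszul g a b) (L.contMDiff_koszul g a b)
    (fun s t x => L.koszul_add_right g a b s t x) fun f s x => L.koszul_smul_right g f a b s x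

/-- The Levi-Civita connection, defined by the Koszul formula. -/
noncomputable def leviCivita : LinearConnection L where
  toFun a b := (L.exists_koszul g a b).choose
  add_left a b s := by
    ext x
    refine inner_ext_sec (E := E) g fun c => ?_
    rw [(L.exists_koszul g (a + b) s).choose_spec, L.koszul_add_left,
      ← (L.exists_koszul g a s).choose_spec, ← (L.exists_koszul g b s).choose_spec,
      ContMDiffSection.coe_add, Pi.add_apply, map_add, _root_.add_apply]
  add_right a s t := by
    ext x
    refine inner_ext_sec (E := E) g fun c => ?_
    rw [(L.exists_koszul g a (s + t)).choose_spec, L.koszul_add_mid,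
      ← (L.exists_koszul g a s).choose_spec, ← (L.exists_koszul g a t).choose_spec,
      ContMDiffSection.coe_add, Pi.add_apply, map_add, _root_.add_apply]
  smul_left f a s := by
    ext x
    refine inner_ext_sec (E := E) g fun c => ?_
    rw [(L.exists_koszul g (smulSec f a) s).choose_spec, L.koszul_smul_left,
      ← (L.exists_koszul g a s).choose_spec, smulSec_apply, map_smul, _root_.smul_apply,
      smul_eq_mul]
  leibniz f a s x := by
    refine inner_ext_sec (E := E) g fun c => ?_
    rw [(L.exists_koszul g a (smulSec f s)).choose_spec, L.koszul_smul_mid,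
      ← (L.exists_koszul g a s).choose_spec, map_add, map_smul, map_smul, _root_.add_apply,
      _root_.smul_apply, _root_.smul_apply, smul_eq_mul, smul_eq_mul]

theorem inner_leviCivita (a b c : Sec E F A) (x : M) :
    g.inner x ((L.leviCivita g).toFun a b x) (c x) = L.koszul g a b c x :=
  (L.exists_koszul g a b).choose_spec c x

theorem isLeviCivita_leviCivita : IsLeviCivita g (L.leviCivita g) where
  metric a b c x := by
    change L.deriv a (innerFun g b c) x = _
    rw [g.symm x (b x), inner_leviCivita, inner_leviCivita, koszul, koszul, innerFun_comm g c b,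
      L.bracket_skew c b]
    simp only [ContMDiffSection.coe_neg, Pi.neg_apply, map_neg, _root_.neg_apply]
    ring
  torsion_free a b := by
    ext x
    refine inner_ext_sec (E := E) g fun c => ?_
    rw [ContMDiffSection.coe_sub, Pi.sub_apply, map_sub, _root_.sub_apply, inner_leviCivita,
      inner_leviCivita, koszul, koszul, innerFun_comm g b a, L.bracket_skew b a]
    simp only [ContMDiffSection.coe_neg, Pi.neg_apply, map_neg, _root_.neg_apply]
    ring

end LieAlgebroid

variable {L : LieAlgebroid E F A} {g : Metric E F A} {D : LinearConnection L}

namespace IsLeviCivita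

theorem torsion (hD : IsLeviCivita g D) (a b : Sec E F A) (x : M) :
    L.bracket a b x = D.toFun a b x - D.toFun b a x := by
  rw [← hD.torsion_free]
  rfl

theorem deriv_inner (hD : IsLeviCivita g D) (a b c : Sec E F A) (x : M) :
    L.deriv a (innerFun g b c) x =
      g.inner x (D.toFun a b x) (c x) + g.inner x (b x) (D.toFun a c x) :=
  hD.metric a b c x

theorem inner_eq_koszul (hD : IsLeviCivita g D) (a b c : Sec E F A) (x : M) :
    g.inner x (D.toFun a b x) (c x) = L.koszul g a b c x := by
  simp only [LieAlgebroid.koszul, hD.torsion, hD.deriv_inner, map_sub, _root_.sub_apply]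
  rw [g.symm x (a x) (D.toFun b c x), g.symm x (b x) (D.toFun a c x),
    g.symm x (a x) (D.toFun c b x)]
  ring

theorem eq_leviCivita (hD : IsLeviCivita g D) : D = L.leviCivita g := by
  ext a b x
  exact inner_ext_sec (E := E) g fun c => by rw [hD.inner_eq_koszul, L.inner_leviCivita]

end IsLeviCivita

theorem existsUnique_leviCivita (L : LieAlgebroid E F A) (g : Metric E F A) :
    ∃! D : LinearConnection L, IsLeviCivita g D :=
  ⟨L.leviCivita g, L.isLeviCivita_leviCivita g, fun _ hD => hD.eq_leviCivita⟩

/-- `D_a b` at `x` depends on `a` only through `a x`. -/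
theorem LinearConnection.toFun_congr (g : Metric E F A) (D : LinearConnection L)
    {a a' : Sec E F A} (b : Sec E F A) {x : M} (h : a x = a' x) :
    D.toFun a b x = D.toFun a' b x := by
  refine inner_ext_sec (E := E) g fun c => ?_
  refine tensorial_congr g (T := fun a => g.inner x (D.toFun a b x) (c x)) (fun s t => ?_)
    (fun f s => ?_) h
  · rw [D.add_left, ContMDiffSection.coe_add, Pi.add_apply, map_add, _root_.add_apply]
  · rw [D.smul_left, smulSec_apply, map_smul, _root_.smul_apply, smul_eq_mul]

theorem LinearConnection.at_eq (g : Metric E F A) (D : LinearConnection L) (v : TotalSpace F A)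
    {a : Sec E F A} (b : Sec E F A) (h : a v.proj = v.2) : D.at v b = D.toFun a b v.proj :=
  D.toFun_congr g b (by rw [sectionThrough_apply, h])

end LeviCivita

/-! ### Testing smoothness and derivatives on coordinate-containing functions -/

section TestFunctions

variable {E' : Type*} [NormedAddCommGroup E'] [NormedSpace ℝ E'] [FiniteDimensional ℝ E']
  {H' : Type*} [TopologicalSpace H'] {J : ModelWithCorners ℝ E' H'}
  {N : Type*} [TopologicalSpace N] [ChartedSpace H' N] [IsManifold J ∞ N]

variable (J) in
/-- A set `𝓗` of smooth functions on a manifold contains coordinates if every coordinate function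
of every preferred chart coincides, near the centre of the chart, with a member of `𝓗`. Tangent
vectors, vector fields and curves can then be tested on `𝓗`. -/
structure ContainsCoordinates (𝓗 : Set (N → ℝ)) : Prop where
  contMDiff : ∀ h ∈ 𝓗, ContMDiff J 𝓘(ℝ, ℝ) ∞ h
  exists_eventuallyEq : ∀ (a : N) (η : E' →L[ℝ] ℝ),
    ∃ h ∈ 𝓗, h =ᶠ[𝓝 a] fun y => η (extChartAt J a y)

theorem eq_sum_finBasis (v : E') : v = ∑ i, (Module.finBasis ℝ E').coord i v •
    Module.finBasis ℝ E' i :=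
  ((Module.finBasis ℝ E').sum_repr v).symm

/-- The coordinate forms of a basis of a finite-dimensional space, as continuous linear forms. -/
noncomputable def coordForm (i : Fin (Module.finrank ℝ E')) : E' →L[ℝ] ℝ :=
  LinearMap.toContinuousLinearMap ((Module.finBasis ℝ E').coord i)

theorem contMDiffWithinAt_of_coordForm {EQ : Type*} [NormedAddCommGroup EQ] [NormedSpace ℝ EQ]
    {HQ : Type*} [TopologicalSpace HQ] {I : ModelWithCorners ℝ EQ HQ}
    {Q : Type*} [TopologicalSpace Q] [ChartedSpace HQ Q] {n : ℕ∞ω} {Φ : Q → E'} {S : Set Q} {y : Q}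
    (h : ∀ i, ContMDiffWithinAt I 𝓘(ℝ, ℝ) n (fun z => coordForm i (Φ z)) S y) :
    ContMDiffWithinAt I 𝓘(ℝ, E') n Φ S y := by
  have : ContMDiffWithinAt I 𝓘(ℝ, E') n
      (fun z => ∑ i, coordForm i (Φ z) • Module.finBasis ℝ E' i) S y :=
    ContMDiffWithinAt.sum fun i _ => (h i).smul contMDiffWithinAt_const
  exact this.congr (fun z _ => eq_sum_finBasis (Φ z)) (eq_sum_finBasis (Φ y))

theorem hasDerivWithinAt_of_coordForm {Φ : ℝ → E'} {w : E'} {S : Set ℝ} {t : ℝ}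
    (h : ∀ i, HasDerivWithinAt (fun z => coordForm i (Φ z)) (coordForm i w) S t) :
    HasDerivWithinAt Φ w S t := by
  have : HasDerivWithinAt
      (fun z => ∑ i, coordForm i (Φ z) • Module.finBasis ℝ E' i)
      (∑ i, coordForm i w • Module.finBasis ℝ E' i) S t :=
    HasDerivWithinAt.fun_sum fun i _ => (h i).smul_const _
  rw [eq_sum_finBasis w]
  exact this.congr (fun z _ => eq_sum_finBasis (Φ z)) (eq_sum_finBasis (Φ t))

variable {𝓗 : Set (N → ℝ)}

/-- The derivative of a coordinate function, near the centre of the chart, is the corresponding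
coordinate of tangent vectors in the trivialization of the tangent bundle. -/
theorem mfderiv_eq_of_eventuallyEq_chart {h : N → ℝ} {a₀ : N} {η : E' →L[ℝ] ℝ}
    (hh : h =ᶠ[𝓝 a₀] fun y => η (extChartAt J a₀ y)) :
    ∀ᶠ a in 𝓝 a₀, ∀ Y : TangentSpace J a, (mfderiv J 𝓘(ℝ, ℝ) h a Y : ℝ) =
      η (trivializationAt E' (TangentSpace J) a₀ (⟨a, Y⟩ : TangentBundle J N)).2 := by
  have hs : ∀ᶠ a in 𝓝 a₀, a ∈ (chartAt H' a₀).source :=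
    (chartAt H' a₀).open_source.mem_nhds (mem_chart_source H' a₀)
  filter_upwards [eventually_eventually_nhds.2 hh, hs] with a ha has Y
  have h1 : HasMFDerivAt J 𝓘(ℝ, E') (extChartAt J a₀) a (mfderiv J 𝓘(ℝ, E') (extChartAt J a₀) a) :=
    (mdifferentiableAt_extChartAt has).hasMFDerivAt
  have h2 : HasMFDerivAt 𝓘(ℝ, E') 𝓘(ℝ, ℝ) η (extChartAt J a₀ a) η :=
    η.hasFDerivAt.hasMFDerivAt
  have h3 := ((h2.comp a h1).congr_of_eventuallyEq ha).mfderiv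
  rw [h3, ← TangentBundle.continuousLinearMapAt_trivializationAt has]
  change η _ = η _
  congr 1
  exact Trivialization.continuousLinearMapAt_apply_of_mem (R := ℝ) _ (by simpa using has) Y

theorem trivializationAt_tangent_self (a : N) (Y : TangentSpace J a) :
    (trivializationAt E' (TangentSpace J) a (⟨a, Y⟩ : TangentBundle J N)).2 = Y := by
  have h := TangentBundle.continuousLinearMapAt_trivializationAt (I := J) (mem_chart_source H' a)
  rw [mfderiv_extChartAt_self] at h
  rw [← Trivialization.continuousLinearMapAt_apply_of_mem (R := ℝ) _
    (FiberBundle.mem_baseSet_trivializationAt' a) Y, h]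
  rfl

theorem ContainsCoordinates.tangent_ext (h𝓗 : ContainsCoordinates J 𝓗) {a : N}
    {Y Z : TangentSpace J a}
    (h : ∀ f ∈ 𝓗, (mfderiv J 𝓘(ℝ, ℝ) f a Y : ℝ) = mfderiv J 𝓘(ℝ, ℝ) f a Z) : Y = Z := by
  refine (SeparatingDual.eq_iff_forall_dual_eq (R := ℝ) (V := E')).2 fun η => ?_
  obtain ⟨f, hf, hfe⟩ := h𝓗.exists_eventuallyEq a η
  have h1 := (mfderiv_eq_of_eventuallyEq_chart hfe).self_of_nhds
  have h2 := h f hf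
  rw [h1, h1, trivializationAt_tangent_self, trivializationAt_tangent_self] at h2
  exact h2

theorem ContainsCoordinates.contMDiff_vectorField (h𝓗 : ContainsCoordinates J 𝓗)
    {X : ∀ a : N, TangentSpace J a}
    (h : ∀ f ∈ 𝓗, ContMDiff J 𝓘(ℝ, ℝ) ∞ fun a => (mfderiv J 𝓘(ℝ, ℝ) f a (X a) : ℝ)) :
    ContMDiff J J.tangent ∞ fun a => (⟨a, X a⟩ : TangentBundle J N) := by
  intro a
  rw [contMDiffAt_section]
  refine contMDiffWithinAt_of_coordForm fun i => ?_
  obtain ⟨f, hf, hfe⟩ := h𝓗.exists_eventuallyEq a (coordForm i)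
  refine (h f hf a).congr_of_eventuallyEq ?_
  filter_upwards [mfderiv_eq_of_eventuallyEq_chart hfe] with b hb
  exact (hb (X b)).symm

theorem ContainsCoordinates.contMDiffWithinAt_curve (h𝓗 : ContainsCoordinates J 𝓗)
    {α : ℝ → N} {S : Set ℝ} {t : ℝ} {n : ℕ∞ω} (hα : ContinuousWithinAt α S t)
    (h : ∀ f ∈ 𝓗, ContDiffWithinAt ℝ n (f ∘ α) S t) :
    ContMDiffWithinAt 𝓘(ℝ, ℝ) J n α S t := by
  refine contMDiffWithinAt_iff_target.2 ⟨hα, contMDiffWithinAt_of_coordForm fun i => ?_⟩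
  obtain ⟨f, hf, hfe⟩ := h𝓗.exists_eventuallyEq (α t) (coordForm i)
  exact (h f hf).contMDiffWithinAt.congr_of_eventuallyEq
    ((hα.eventually hfe).mono fun u hu => hu.symm) hfe.self_of_nhds.symm

theorem ContainsCoordinates.hasMFDerivWithinAt_curve (h𝓗 : ContainsCoordinates J 𝓗)
    {α : ℝ → N} {S : Set ℝ} {t : ℝ} {Y : TangentSpace J (α t)} (hα : ContinuousWithinAt α S t)
    (h : ∀ f ∈ 𝓗, HasDerivWithinAt (f ∘ α) (mfderiv J 𝓘(ℝ, ℝ) f (α t) Y : ℝ) S t) :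
    HasMFDerivWithinAt 𝓘(ℝ, ℝ) J α S t ((1 : ℝ →L[ℝ] ℝ).smulRight Y) := by
  refine ⟨hα, ?_⟩
  simp only [mfld_simps]
  have : HasDerivWithinAt (extChartAt J (α t) ∘ α) (Y : E') S t := by
    refine hasDerivWithinAt_of_coordForm fun i => ?_
    obtain ⟨f, hf, hfe⟩ := h𝓗.exists_eventuallyEq (α t) (coordForm i)
    have h1 := (h f hf).congr_of_eventuallyEq
      ((hα.eventually hfe).mono fun u hu => hu.symm) hfe.self_of_nhds.symm
    rwa [(mfderiv_eq_of_eventuallyEq_chart hfe).self_of_nhds, trivializationAt_tangent_self] at h1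
  exact this.hasFDerivWithinAt

/-- The chain rule `(f ∘ α)' = df(α')`, with the velocity `α'` given as a tangent vector. -/
theorem hasDerivWithinAt_comp_curve {f : N → ℝ} {α : ℝ → N} {S : Set ℝ} {t : ℝ}
    {Y : TangentSpace J (α t)} (hf : ContMDiff J 𝓘(ℝ, ℝ) ∞ f)
    (hα : HasMFDerivWithinAt 𝓘(ℝ, ℝ) J α S t ((1 : ℝ →L[ℝ] ℝ).smulRight Y)) :
    HasDerivWithinAt (f ∘ α) (mfderiv J 𝓘(ℝ, ℝ) f (α t) Y : ℝ) S t := by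
  let φ : E' →L[ℝ] ℝ := mfderiv J 𝓘(ℝ, ℝ) f (α t)
  let y : E' := Y
  have h1 : HasFDerivWithinAt (f ∘ α) (φ.comp ((1 : ℝ →L[ℝ] ℝ).smulRight y)) S t :=
    ((hf.mdifferentiable (by simp) (α t)).hasMFDerivAt.comp_hasMFDerivWithinAt t
      hα).hasFDerivWithinAt
  have h2 := h1.hasDerivWithinAt
  rw [ContinuousLinearMap.comp_apply, ContinuousLinearMap.smulRight_apply,
    one_apply_eq_self, one_smul] at h2
  exact h2

end TestFunctions

/-! ### The bracket with the energy -/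

section Hamiltonian

variable {E : Type*} [NormedAddCommGroup E] [NormedSpace ℝ E] [FiniteDimensional ℝ E]
  {M : Type*} [TopologicalSpace M] [ChartedSpace E M] [IsManifold 𝓘(ℝ, E) ∞ M] [T2Space M]
  {F : Type*} [NormedAddCommGroup F] [NormedSpace ℝ F] [FiniteDimensional ℝ F]
  {A : M → Type*} [TopologicalSpace (TotalSpace F A)] [∀ x, AddCommGroup (A x)]
  [∀ x, Module ℝ (A x)] [∀ x, TopologicalSpace (A x)] [FiberBundle F A] [VectorBundle ℝ F A]
  [ContMDiffVectorBundle ∞ F A 𝓘(ℝ, E)]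
  [∀ x, IsTopologicalAddGroup (A x)] [∀ x, ContinuousSMul ℝ (A x)]

theorem containsCoordinates_base :
    ContainsCoordinates 𝓘(ℝ, E) {f : M → ℝ | ContMDiff 𝓘(ℝ, E) 𝓘(ℝ, ℝ) ∞ f} where
  contMDiff _ h := h
  exists_eventuallyEq x₀ η := by
    have hx₀ : ∀ᶠ x in 𝓝 x₀, x ∈ (chartAt E x₀).source :=
      (chartAt E x₀).open_source.mem_nhds (mem_chart_source E x₀)
    obtain ⟨h, hh⟩ := exists_smooth_eventuallyEq (E := E) (x₀ := x₀)
      (f := fun y => η (extChartAt 𝓘(ℝ, E) x₀ y))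
      (hx₀.mono fun x hx => η.contDiff.contMDiff.contMDiffAt.comp x (contMDiffAt_extChartAt' hx))
    exact ⟨h, h.contMDiff, hh⟩

variable (g : Metric E F A)

/-- The fibrewise affine function `f ∘ p + ⟨·, c⟩` on `A`. -/
noncomputable def affineFun (f : C^∞⟮𝓘(ℝ, E), M; 𝓘(ℝ, ℝ), ℝ⟯) (c : Sec E F A)
    (v : TotalSpace F A) : ℝ :=
  f v.proj + pairing g c v

theorem contMDiff_affineFun (f : C^∞⟮𝓘(ℝ, E), M; 𝓘(ℝ, ℝ), ℝ⟯) (c : Sec E F A) :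
    ContMDiff (𝓘(ℝ, E).prod 𝓘(ℝ, F)) 𝓘(ℝ, ℝ) ∞ (affineFun g f c) :=
  (f.contMDiff.comp (contMDiff_proj A)).add (contMDiff_pairing g c)

/-- Fibrewise affine functions detect tangent vectors of `A`: coordinates of the base are functions
on `M`, and linear coordinates of the fibre are pairings with sections of the dual frame. -/
theorem containsCoordinates_affineFun :
    ContainsCoordinates (𝓘(ℝ, E).prod 𝓘(ℝ, F)) {h : TotalSpace F A → ℝ |
      ∃ (f : C^∞⟮𝓘(ℝ, E), M; 𝓘(ℝ, ℝ), ℝ⟯) (c : Sec E F A), h = affineFun g f c} where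
  contMDiff := by
    rintro _ ⟨f, c, rfl⟩
    exact contMDiff_affineFun g f c
  exists_eventuallyEq a η := by
    obtain ⟨f, hf, hfe⟩ := containsCoordinates_base.exists_eventuallyEq a.proj
      (η.comp (ContinuousLinearMap.inl ℝ E F))
    obtain ⟨e, e', he⟩ := exists_dual_frames g a.proj
    let c : Sec E F A := ∑ i, (η (0, Module.finBasis ℝ F i)) • e' i
    refine ⟨_, ⟨⟨f, hf⟩, c, rfl⟩, ?_⟩
    have hT : ∀ᶠ x in 𝓝 a.proj, x ∈ (trivializationAt F A a.proj).baseSet :=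
      (trivializationAt F A a.proj).open_baseSet.mem_nhds
        (FiberBundle.mem_baseSet_trivializationAt' a.proj)
    have hp : Tendsto (TotalSpace.proj : TotalSpace F A → M) (𝓝 a) (𝓝 a.proj) :=
      (contMDiff_proj (IB := 𝓘(ℝ, E)) (n := ∞) A).continuous.tendsto a
    filter_upwards [hp.eventually hfe, hp.eventually he, hp.eventually hT] with v hv1 hv2 hv3
    have h1 : extChartAt (𝓘(ℝ, E).prod 𝓘(ℝ, F)) a v =
        (extChartAt 𝓘(ℝ, E) a.proj v.proj, (trivializationAt F A a.proj v).2) := by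
      rw [FiberBundle.extChartAt]
      change (extChartAt 𝓘(ℝ, E) a.proj (trivializationAt F A a.proj v).1, _) = _
      rw [Trivialization.coe_fst' _ hv3]
      rfl
    have h2 : ∀ (x : E) (y : F), η (x, y) = η (x, 0) + η (0, y) := fun x y => by
      rw [← map_add]; simp
    have h3 : c v.proj = ∑ i, (η (0, Module.finBasis ℝ F i)) • e' i v.proj := by
      have h0 := congrFun (map_sum (ContMDiffSection.coeAddHom 𝓘(ℝ, E) F ∞ A)
        (fun i => (η (0, Module.finBasis ℝ F i)) • e' i) Finset.univ) v.proj
      rw [Finset.sum_apply] at h0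
      exact h0
    change f v.proj + g.inner v.proj v.2 (c v.proj) = _
    rw [h1, h2, h3, (hv2 v.2).2]
    refine congrArg₂ _ hv1 ?_
    have h4 : ∀ y : F, η (0, y) = η.comp (ContinuousLinearMap.inr ℝ E F) y := fun y => rfl
    simp only [h4, map_sum, map_smul, smul_eq_mul]
    exact Finset.sum_congr rfl fun i _ => mul_comm _ _

theorem inner_musical_symm (μ : DualSpace F A) :
    g.inner μ.proj ((musical g).symm μ).2 = μ.2 :=
  (Equiv.ofBijective _ (flat_bijective g μ.proj)).apply_symm_apply μ.2

theorem musical_symm_mk {x : M} {φ : A x →L[ℝ] ℝ} {v : A x} (h : g.inner x v = φ) :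
    (musical g).symm (⟨x, φ⟩ : DualSpace F A) = ⟨x, v⟩ := by
  rw [Equiv.symm_apply_eq]
  subst h
  rfl

theorem contMDiff_dual_apply {EN : Type*} [NormedAddCommGroup EN] [NormedSpace ℝ EN]
    {HN : Type*} [TopologicalSpace HN] {J : ModelWithCorners ℝ EN HN}
    {N : Type*} [TopologicalSpace N] [ChartedSpace HN N] {Φ : N → DualSpace F A}
    (hΦ : ContMDiff J (𝓘(ℝ, E).prod 𝓘(ℝ, F →L[ℝ] ℝ)) ∞ Φ) (c : Sec E F A) :
    ContMDiff J 𝓘(ℝ, ℝ) ∞ (fun y => ((Φ y).2 (c (Φ y).proj) : ℝ)) := by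
  have hb : ContMDiff J 𝓘(ℝ, E) ∞ (fun y => (Φ y).proj) :=
    fun y => (contMDiffAt_totalSpace.1 (hΦ y)).1
  have : ContMDiff J (𝓘(ℝ, E).prod 𝓘(ℝ, ℝ)) ∞
      (fun y => TotalSpace.mk' ℝ (E := Bundle.Trivial M ℝ) (Φ y).proj
        ((Φ y).2 (c (Φ y).proj))) :=
    ContMDiff.clm_bundle_apply (F₁ := F) (F₂ := ℝ) hΦ (c.contMDiff.comp hb)
  exact fun y => (contMDiffAt_totalSpace.1 (this y)).2

/-- The inverse `A* → A` of the metric isomorphism is smooth: its pairing with a section `c` of `A`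
is evaluation at `c`. -/
theorem contMDiff_musical_symm :
    ContMDiff (𝓘(ℝ, E).prod 𝓘(ℝ, F →L[ℝ] ℝ)) (𝓘(ℝ, E).prod 𝓘(ℝ, F)) ∞ (musical g).symm := by
  intro μ
  refine contMDiffWithinAt_of_pairing g (contMDiff_proj _ μ) fun c => ?_
  refine (contMDiff_dual_apply (Φ := fun μ : DualSpace F A => μ) contMDiff_id c
    μ).congr_of_eventuallyEq (Eventually.of_forall fun ν => ?_)
  exact congrArg (fun φ : A ν.proj →L[ℝ] ℝ => φ (c ν.proj)) (inner_musical_symm g ν)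

/-- The fibre derivative of a function transported to `A*` is its fibre gradient for the metric. -/
theorem hasDerivAt_fiber {h : TotalSpace F A → ℝ}
    (hh : ContMDiff (𝓘(ℝ, E).prod 𝓘(ℝ, F)) 𝓘(ℝ, ℝ) ∞ h) (a : TotalSpace F A) (v : A a.proj) :
    HasDerivAt (fun t : ℝ => h ⟨a.proj, a.2 + t • v⟩)
      (g.inner a.proj v (fiberDeriv (h ∘ (musical g).symm) (musical g a))) 0 := by
  have h1 := fiberDeriv_spec (hh.comp (contMDiff_musical_symm g)) (musical g a) (g.inner a.proj v)
  refine h1.congr_of_eventuallyEq (Eventually.of_forall fun t => ?_)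
  have h2 : g.inner a.proj (a.2 + t • v) = g.inner a.proj a.2 + t • g.inner a.proj v := by
    rw [map_add, map_smul]
  exact congrArg h (musical_symm_mk g h2).symm

/-- The Legendre transform of the energy is the metric isomorphism `A ≃ A*`. -/
theorem fiberDeriv_energy (a : TotalSpace F A) :
    fiberDeriv (energy g ∘ (musical g).symm) (musical g a) = a.2 := by
  refine inner_ext g (x := a.proj) fun v => ?_
  refine (g.symm a.proj _ v).trans ((hasDerivAt_fiber g (contMDiff_energy g) a v).unique ?_)
  have h1 : HasDerivAt (fun t : ℝ => (1 / 2) * g.inner a.proj a.2 a.2 +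
      t * g.inner a.proj a.2 v + (t * t) * ((1 / 2) * g.inner a.proj v v))
      (g.inner a.proj a.2 v) 0 := by
    have h2 := (((hasDerivAt_id (0 : ℝ)).mul_const (g.inner a.proj a.2 v)).const_add
      ((1 / 2) * g.inner a.proj a.2 a.2)).add
      (((hasDerivAt_id (0 : ℝ)).mul (hasDerivAt_id (0 : ℝ))).mul_const
        ((1 / 2) * g.inner a.proj v v))
    convert! h2 using 1
    simp
  refine h1.congr_of_eventuallyEq (Eventually.of_forall fun t => ?_)
  simp only [energy, map_add, map_smul, _root_.add_apply, _root_.smul_apply, smul_eq_mul]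
  rw [g.symm a.proj v a.2]
  ring

/-- The vertical lift of `v` at `a`: the velocity of `t ↦ a + t v`. -/
theorem exists_verticalLift (g : Metric E F A) (a : TotalSpace F A) (v : A a.proj) :
    ∃ Y : TangentSpace (𝓘(ℝ, E).prod 𝓘(ℝ, F)) a, ∀ h : TotalSpace F A → ℝ,
      ContMDiff (𝓘(ℝ, E).prod 𝓘(ℝ, F)) 𝓘(ℝ, ℝ) ∞ h →
      HasDerivAt (fun t : ℝ => h ⟨a.proj, a.2 + t • v⟩)
        (mfderiv (𝓘(ℝ, E).prod 𝓘(ℝ, F)) 𝓘(ℝ, ℝ) h a Y : ℝ) 0 := by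
  let β : ℝ → TotalSpace F A := fun t => ⟨a.proj, a.2 + t • v⟩
  have hβ0 : β 0 = a := by simp [β]
  have hβ : ContMDiffAt 𝓘(ℝ, ℝ) (𝓘(ℝ, E).prod 𝓘(ℝ, F)) ∞ β 0 := by
    refine contMDiffWithinAt_of_pairing g contMDiffWithinAt_const fun c => ?_
    simp only [pairing, β, map_add, map_smul, _root_.add_apply, _root_.smul_apply, smul_eq_mul]
    have h1 : ContDiff ℝ ∞ fun t : ℝ =>
        g.inner a.proj a.2 (c a.proj) + t * g.inner a.proj v (c a.proj) :=
      contDiff_const.add (contDiff_id.mul contDiff_const)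
    exact h1.contMDiff.contMDiffAt
  have key : ∃ Y : TangentSpace (𝓘(ℝ, E).prod 𝓘(ℝ, F)) (β 0), ∀ h : TotalSpace F A → ℝ,
      ContMDiff (𝓘(ℝ, E).prod 𝓘(ℝ, F)) 𝓘(ℝ, ℝ) ∞ h →
      HasDerivAt (h ∘ β) (mfderiv (𝓘(ℝ, E).prod 𝓘(ℝ, F)) 𝓘(ℝ, ℝ) h (β 0) Y : ℝ) 0 := by
    let φ : ℝ →L[ℝ] E × F := mfderiv 𝓘(ℝ, ℝ) (𝓘(ℝ, E).prod 𝓘(ℝ, F)) β 0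
    have hφ : φ = (1 : ℝ →L[ℝ] ℝ).smulRight (φ 1) := by
      refine ContinuousLinearMap.ext_ring ?_
      rw [ContinuousLinearMap.smulRight_apply, one_apply_eq_self, one_smul]
    have h0 : HasMFDerivAt 𝓘(ℝ, ℝ) (𝓘(ℝ, E).prod 𝓘(ℝ, F)) β 0 φ :=
      (hβ.mdifferentiableAt (by simp)).hasMFDerivAt
    rw [hφ] at h0
    have h1 : HasMFDerivWithinAt 𝓘(ℝ, ℝ) (𝓘(ℝ, E).prod 𝓘(ℝ, F)) β univ 0
        ((1 : ℝ →L[ℝ] ℝ).smulRight (φ 1)) := h0.hasMFDerivWithinAt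
    exact ⟨φ 1, fun h hh => (hasDerivWithinAt_comp_curve hh h1).hasDerivAt univ_mem⟩
  rw [hβ0] at key
  exact key

theorem dirDeriv_sub {f h : M → ℝ} (hf : ContMDiff 𝓘(ℝ, E) 𝓘(ℝ, ℝ) ∞ f)
    (hh : ContMDiff 𝓘(ℝ, E) 𝓘(ℝ, ℝ) ∞ h) (x : M) (X : TangentSpace 𝓘(ℝ, E) x) :
    dirDeriv (fun y => f y - h y) x X = dirDeriv f x X - dirDeriv h x X := by
  have h1 := (hf.mdifferentiable (by simp) x).hasMFDerivAt.sub
    (hh.mdifferentiable (by simp) x).hasMFDerivAt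
  exact congrArg (fun φ => φ X) h1.mfderiv

theorem dirDeriv_const_mul (r : ℝ) {f : M → ℝ} (hf : ContMDiff 𝓘(ℝ, E) 𝓘(ℝ, ℝ) ∞ f)
    (x : M) (X : TangentSpace 𝓘(ℝ, E) x) :
    dirDeriv (fun y => r * f y) x X = r * dirDeriv f x X := by
  have h1 := (hf.mdifferentiable (by simp) x).hasMFDerivAt.const_smul r
  exact congrArg (fun φ => φ X) h1.mfderiv

/-- The covariant formula for the Hamiltonian vector field: `{E, h}(a) = d(h ∘ s)(#a) - ⟨D_a s, w⟩`,
where `s` is a section through `a` and `w` is the fibre gradient of `h` at `a`. -/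
theorem exists_metricBracket_energy {L : LieAlgebroid E F A} {D : LinearConnection L}
    (hD : IsLeviCivita g D) (a : TotalSpace F A) :
    ∃ s b : Sec E F A, s a.proj = a.2 ∧ b a.proj = a.2 ∧ ∀ h : TotalSpace F A → ℝ,
      ContMDiff (𝓘(ℝ, E).prod 𝓘(ℝ, F)) 𝓘(ℝ, ℝ) ∞ h → ∃ w : A a.proj,
      (∀ v : A a.proj, HasDerivAt (fun t : ℝ => h ⟨a.proj, a.2 + t • v⟩)
        (g.inner a.proj v w) 0) ∧
      metricBracket L g (energy g) h a =
        L.deriv b (fun x => h ⟨x, s x⟩) a.proj - g.inner a.proj (D.toFun b s a.proj) w := by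
  -- the sections chosen in `dualBracket`: `ξ` through `⟨a, ·⟩`, and `b`, `c` through the fibre
  -- derivatives of the energy and of `h`; `s` is the section of `A` dual to `ξ`
  let ξ : DualSec E F A := sectionThrough E (musical g a)
  have hξa : ξ a.proj = g.inner a.proj a.2 := sectionThrough_apply (musical g a)
  obtain ⟨s, hs⟩ := exists_riesz g (fun c x => (ξ x (c x) : ℝ))
    (fun c => contMDiff_dual_apply (Φ := fun x => ⟨x, ξ x⟩) ξ.contMDiff c)
    (fun s t x => map_add (ξ x) (s x) (t x)) (fun f s x => map_smul (ξ x) (f x) (s x))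
  have hsξ (x) : g.inner x (s x) = ξ x := by
    ext v
    have h1 := hs (sectionThrough E ⟨x, v⟩) x
    rwa [sectionThrough_apply (E := E) (⟨x, v⟩ : TotalSpace F A)] at h1
  have hsa : s a.proj = a.2 := (flat_bijective g a.proj).1 ((hsξ a.proj).trans hξa)
  let b : Sec E F A := sectionThrough E
    (⟨a.proj, fiberDeriv (energy g ∘ (musical g).symm) (musical g a)⟩ : TotalSpace F A)
  have hba : b a.proj = a.2 := (sectionThrough_apply (E := E)
    (⟨a.proj, fiberDeriv (energy g ∘ (musical g).symm) (musical g a)⟩ : TotalSpace F A)).trans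
    (fiberDeriv_energy g a)
  refine ⟨s, b, hsa, hba, fun h hh => ⟨fiberDeriv (h ∘ (musical g).symm) (musical g a),
    hasDerivAt_fiber g hh a, ?_⟩⟩
  let c : Sec E F A := sectionThrough E
    (⟨a.proj, fiberDeriv (h ∘ (musical g).symm) (musical g a)⟩ : TotalSpace F A)
  have hca : c a.proj = fiberDeriv (h ∘ (musical g).symm) (musical g a) :=
    sectionThrough_apply (E := E)
      (⟨a.proj, fiberDeriv (h ∘ (musical g).symm) (musical g a)⟩ : TotalSpace F A)
  have h1 : metricBracket L g (energy g) h a = ξ a.proj (L.bracket b c a.proj)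
      + L.deriv b (fun x => h ((musical g).symm ⟨x, ξ x⟩) - ξ x (c x)) a.proj
      - L.deriv c (fun x => energy g ((musical g).symm ⟨x, ξ x⟩) - ξ x (b x)) a.proj := rfl
  have h2 : (fun x => h ((musical g).symm ⟨x, ξ x⟩) - ξ x (c x)) =
      fun x => h ⟨x, s x⟩ - innerFun g s c x := by
    funext x
    rw [musical_symm_mk g (hsξ x), ← hsξ]
    rfl
  have h3 : (fun x => energy g ((musical g).symm ⟨x, ξ x⟩) - ξ x (b x)) =
      fun x => (1 / 2) * innerFun g s s x - innerFun g s b x := by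
    funext x
    rw [musical_symm_mk g (hsξ x), ← hsξ]
    rfl
  have h4 : L.deriv b (fun x => h ⟨x, s x⟩ - innerFun g s c x) a.proj =
      L.deriv b (fun x => h ⟨x, s x⟩) a.proj - L.deriv b (innerFun g s c) a.proj :=
    dirDeriv_sub (hh.comp s.contMDiff) (innerFun g s c).contMDiff _ _
  have h5 : L.deriv c (fun x => (1 / 2) * innerFun g s s x - innerFun g s b x) a.proj =
      (1 / 2) * L.deriv c (innerFun g s s) a.proj - L.deriv c (innerFun g s b) a.proj := by
    have h6 : ContMDiff 𝓘(ℝ, E) 𝓘(ℝ, ℝ) ∞ (fun x => (1 / 2) * innerFun g s s x) :=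
      contMDiff_const.mul (innerFun g s s).contMDiff
    rw [LieAlgebroid.deriv, dirDeriv_sub h6 (innerFun g s b).contMDiff,
      dirDeriv_const_mul _ (innerFun g s s).contMDiff]
    rfl
  -- expand `[b, c] = D_b c - D_c b` and the derivatives of scalar products
  rw [h1, h2, h3, h4, h5, hD.deriv_inner, hD.deriv_inner, hD.deriv_inner, hD.torsion, ← hsξ,
    ← hca, hsa, hba, map_sub, g.symm a.proj (D.toFun c s a.proj) a.2]
  ring

end Hamiltonian

/-! ### The Hamiltonian vector field and the geodesic equation -/

section GeodesicFlow

variable {E : Type*} [NormedAddCommGroup E] [NormedSpace ℝ E] [FiniteDimensional ℝ E]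
  {M : Type*} [TopologicalSpace M] [ChartedSpace E M] [IsManifold 𝓘(ℝ, E) ∞ M] [T2Space M]
  {F : Type*} [NormedAddCommGroup F] [NormedSpace ℝ F] [FiniteDimensional ℝ F]
  {A : M → Type*} [TopologicalSpace (TotalSpace F A)] [∀ x, AddCommGroup (A x)]
  [∀ x, Module ℝ (A x)] [∀ x, TopologicalSpace (A x)] [FiberBundle F A] [VectorBundle ℝ F A]
  [ContMDiffVectorBundle ∞ F A 𝓘(ℝ, E)]
  [∀ x, IsTopologicalAddGroup (A x)] [∀ x, ContinuousSMul ℝ (A x)]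
  {L : LieAlgebroid E F A} {g : Metric E F A} {D : LinearConnection L}

/-- The Hamiltonian vector of `E` at `a` is the horizontal lift of `#a`: the image of `#a` under the
derivative of a section `s` through `a`, minus the vertical lift of `D_a s`. -/
theorem exists_hamiltonianVector (hD : IsLeviCivita g D) (a : TotalSpace F A) :
    ∃ Y : TangentSpace (𝓘(ℝ, E).prod 𝓘(ℝ, F)) a, ∀ h : TotalSpace F A → ℝ,
      ContMDiff (𝓘(ℝ, E).prod 𝓘(ℝ, F)) 𝓘(ℝ, ℝ) ∞ h →
      (mfderiv (𝓘(ℝ, E).prod 𝓘(ℝ, F)) 𝓘(ℝ, ℝ) h a Y : ℝ) = metricBracket L g (energy g) h a := by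
  obtain ⟨s, b, hs, hb, H⟩ := exists_metricBracket_energy g hD a
  have hsa : (⟨a.proj, s a.proj⟩ : TotalSpace F A) = a := by rw [hs]
  have key : ∃ Y : TangentSpace (𝓘(ℝ, E).prod 𝓘(ℝ, F)) (⟨a.proj, s a.proj⟩ : TotalSpace F A),
      ∀ h : TotalSpace F A → ℝ, ContMDiff (𝓘(ℝ, E).prod 𝓘(ℝ, F)) 𝓘(ℝ, ℝ) ∞ h →
      (mfderiv (𝓘(ℝ, E).prod 𝓘(ℝ, F)) 𝓘(ℝ, ℝ) h ⟨a.proj, s a.proj⟩ Y : ℝ) =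
        L.deriv b (fun x => h ⟨x, s x⟩) a.proj := by
    refine ⟨mfderiv 𝓘(ℝ, E) (𝓘(ℝ, E).prod 𝓘(ℝ, F)) (fun x => (⟨x, s x⟩ : TotalSpace F A)) a.proj
      (L.anchor a.proj (b a.proj)), fun h hh => ?_⟩
    have h1 := ((hh.mdifferentiable (by simp) ⟨a.proj, s a.proj⟩).hasMFDerivAt.comp a.proj
      (s.contMDiff.mdifferentiable (by simp) a.proj).hasMFDerivAt).mfderiv
    exact (congrArg (fun φ => φ (L.anchor a.proj (b a.proj))) h1).symm
  rw [hsa] at key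
  obtain ⟨Y, hY⟩ := key
  obtain ⟨Z, hZ⟩ := exists_verticalLift g a (D.toFun b s a.proj)
  refine ⟨Y - Z, fun h hh => ?_⟩
  obtain ⟨w, hw, hwb⟩ := H h hh
  rw [hwb, ← hY h hh, (hw (D.toFun b s a.proj)).unique (hZ h hh)]
  exact map_sub (mfderiv (𝓘(ℝ, E).prod 𝓘(ℝ, F)) 𝓘(ℝ, ℝ) h a) Y Z

/-- In `d(h ∘ s)(#a) - ⟨D_a s, w⟩` the section `s` drops out when `h` is fibrewise affine. -/
theorem metricBracket_energy_affineFun (hD : IsLeviCivita g D) (a : TotalSpace F A)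
    (f : C^∞⟮𝓘(ℝ, E), M; 𝓘(ℝ, ℝ), ℝ⟯) (c : Sec E F A) :
    metricBracket L g (energy g) (affineFun g f c) a =
      dirDeriv f a.proj (L.anchor a.proj a.2) + g.inner a.proj a.2 (D.at a c) := by
  obtain ⟨s, b, hs, hb, H⟩ := exists_metricBracket_energy g hD a
  obtain ⟨w, hw, hwb⟩ := H _ (contMDiff_affineFun g f c)
  have h1 : w = c a.proj := by
    refine inner_ext g fun v => ?_
    rw [g.symm]
    have h2 : HasDerivAt (fun t : ℝ => (f a.proj + g.inner a.proj a.2 (c a.proj)) +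
        t * g.inner a.proj v (c a.proj)) (g.inner a.proj v (c a.proj)) 0 := by
      simpa using ((hasDerivAt_id (0 : ℝ)).mul_const (g.inner a.proj v (c a.proj))).const_add
        (f a.proj + g.inner a.proj a.2 (c a.proj))
    rw [g.symm a.proj (c a.proj) v]
    refine (hw v).unique (h2.congr_of_eventuallyEq (Eventually.of_forall fun t => ?_))
    simp only [affineFun, pairing, map_add, map_smul, _root_.add_apply, _root_.smul_apply,
      smul_eq_mul]
    ring
  have h3 : L.deriv b (fun x => affineFun g f c ⟨x, s x⟩) a.proj =
      L.deriv b f a.proj + L.deriv b (innerFun g s c) a.proj :=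
    dirDeriv_add f.contMDiff (innerFun g s c).contMDiff _ _
  rw [hwb, h3, hD.deriv_inner, h1, D.at_eq g a c hb, LieAlgebroid.deriv, hb, hs]
  ring

/-- The function `a ↦ ⟨a, D_a c⟩` on `A` is smooth. -/
theorem contMDiff_inner_at (g : Metric E F A) (D : LinearConnection L) (c : Sec E F A) :
    ContMDiff (𝓘(ℝ, E).prod 𝓘(ℝ, F)) 𝓘(ℝ, ℝ) ∞
      (fun a : TotalSpace F A => g.inner a.proj a.2 (D.at a c)) := by
  intro a₀
  obtain ⟨e, e', he⟩ := exists_dual_frames g a₀.proj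
  have hp : Tendsto (TotalSpace.proj : TotalSpace F A → M) (𝓝 a₀) (𝓝 a₀.proj) :=
    (contMDiff_proj (IB := 𝓘(ℝ, E)) (n := ∞) A).continuous.tendsto a₀
  have h1 : ContMDiffAt (𝓘(ℝ, E).prod 𝓘(ℝ, F)) 𝓘(ℝ, ℝ) ∞
      (fun a : TotalSpace F A => ∑ i, pairing g (e' i) a * pairing g (D.toFun (e i) c) a) a₀ :=
    ContMDiffAt.sum fun i _ => (contMDiff_pairing g (e' i) a₀).mul (contMDiff_pairing g _ a₀)
  refine h1.congr_of_eventuallyEq ?_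
  filter_upwards [hp.eventually (eventually_eventually_nhds.2 he)] with a ha
  have h2 := tensorial_eq_sum g (T := fun b => g.inner a.proj a.2 (D.toFun b c a.proj))
    (fun s t => by rw [D.add_left, ContMDiffSection.coe_add, Pi.add_apply, map_add])
    (fun f s => by rw [D.smul_left, smulSec_apply, map_smul, smul_eq_mul])
    (ha.mono fun y hy v => (hy v).1) (sectionThrough E a)
  rw [sectionThrough_apply] at h2
  exact h2

theorem existsUnique_hamiltonianVectorField (L : LieAlgebroid E F A) (g : Metric E F A) :
    ∃! X : ∀ a : TotalSpace F A, TangentSpace (𝓘(ℝ, E).prod 𝓘(ℝ, F)) a,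
      IsHamiltonianVectorField L g (energy g) X := by
  have hD := L.isLeviCivita_leviCivita g
  choose X hX using fun a => exists_hamiltonianVector hD a
  refine ⟨X, ⟨(containsCoordinates_affineFun g).contMDiff_vectorField ?_, fun h hh a => hX a h hh⟩,
    fun Y hY => funext fun a => (containsCoordinates_affineFun g).tangent_ext ?_⟩
  · rintro _ ⟨f, c, rfl⟩
    simp only [hX _ _ (contMDiff_affineFun g f c), metricBracket_energy_affineFun hD]
    exact (L.contMDiff_dirDeriv_anchor f.contMDiff).add (contMDiff_inner_at g _ c)
  · rintro _ ⟨f, c, rfl⟩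
    rw [hX _ _ (contMDiff_affineFun g f c), hY.2 _ (contMDiff_affineFun g f c)]

theorem snd_eq_of_eq_mk {v : TotalSpace F A} {y : A v.proj} (h : v = ⟨v.proj, y⟩) : v.2 = y := by
  obtain ⟨x, v⟩ := v
  simpa using h

/-- The product rule `⟨α, c⟩' = ⟨D^α α, c⟩ + ⟨α, D_α c⟩` along a curve over its anchor. -/
theorem hasDerivWithinAt_pairing (hD : IsLeviCivita g D) {α : ℝ → TotalSpace F A} {S : Set ℝ}
    {t : ℝ} (ht : t ∈ S)
    (hα : HasMFDerivWithinAt 𝓘(ℝ, ℝ) 𝓘(ℝ, E) (fun u => (α u).proj) S t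
      ((1 : ℝ →L[ℝ] ℝ).smulRight (L.anchor (α t).proj (α t).2)))
    {w : A (α t).proj} (hw : HasCovDerivAlong D S α α t w) (c : Sec E F A) :
    HasDerivWithinAt (pairing g c ∘ α)
      (g.inner (α t).proj w (c (α t).proj) + g.inner (α t).proj (α t).2 (D.at (α t) c)) S t := by
  obtain ⟨n, f, b, hf, hb, rfl⟩ := hw
  have hat (s : Sec E F A) : g.inner (α t).proj (α t).2 (D.at (α t) s) =
      ∑ k, f k t * g.inner (α t).proj (b k (α t).proj) (D.at (α t) s) := by
    conv_lhs => rw [snd_eq_of_eq_mk (hb.self_of_nhdsWithin ht)]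
    simp only [map_sum, map_smul, _root_.sum_apply, _root_.smul_apply, smul_eq_mul]
  have h1 (k) : HasDerivWithinAt (fun u => f k u * innerFun g (b k) c (α u).proj)
      (derivWithin (f k) S t * innerFun g (b k) c (α t).proj +
        f k t * dirDeriv (innerFun g (b k) c) (α t).proj (L.anchor (α t).proj (α t).2)) S t :=
    ((hf k).differentiableWithinAt (by simp)).hasDerivWithinAt.mul
      (hasDerivWithinAt_comp_curve (innerFun g (b k) c).contMDiff hα)
  have h2 (k) : dirDeriv (innerFun g (b k) c) (α t).proj (L.anchor (α t).proj (α t).2) =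
      g.inner (α t).proj (D.at (α t) (b k)) (c (α t).proj) +
        g.inner (α t).proj (b k (α t).proj) (D.at (α t) c) := by
    have h3 := hD.deriv_inner (sectionThrough E (α t)) (b k) c (α t).proj
    rw [LieAlgebroid.deriv, sectionThrough_apply] at h3
    exact h3
  have h3 : ∀ᶠ u in 𝓝[S] t, (pairing g c ∘ α) u =
      ∑ k, f k u * innerFun g (b k) c (α u).proj := by
    filter_upwards [hb] with u hu
    rw [Function.comp_apply, pairing]
    conv_lhs => rw [snd_eq_of_eq_mk hu]
    simp only [map_sum, map_smul, _root_.sum_apply, _root_.smul_apply, smul_eq_mul, innerFun_apply]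
  refine ((HasDerivWithinAt.fun_sum fun k _ => h1 k).congr_of_eventuallyEq h3
    (h3.self_of_nhdsWithin ht)).congr_deriv ?_
  rw [hat, map_sum, _root_.sum_apply, ← Finset.sum_add_distrib]
  refine Finset.sum_congr rfl fun k _ => ?_
  rw [h2, innerFun_apply]
  simp only [map_add, map_smul, _root_.add_apply, _root_.smul_apply, smul_eq_mul]
  ring

theorem uniqueDiffOn_of_ordConnected {S : Set ℝ} (hS : S.OrdConnected) (hS' : S.Nontrivial) :
    UniqueDiffOn ℝ S := by
  obtain ⟨a, ha, b, hb, hab⟩ := hS'.exists_lt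
  refine uniqueDiffOn_convex hS.convex ⟨(a + b) / 2, ?_⟩
  exact interior_maximal (Ioo_subset_Icc_self.trans (hS.out ha hb)) isOpen_Ioo
    ⟨by linarith, by linarith⟩

/-- Regularity bootstrap: an integral curve of a smooth vector field is smooth. -/
theorem ContainsCoordinates.contMDiffOn_of_isMIntegralCurveOn {E' : Type*} [NormedAddCommGroup E']
    [NormedSpace ℝ E'] [FiniteDimensional ℝ E'] {H' : Type*} [TopologicalSpace H']
    {J : ModelWithCorners ℝ E' H'} {N : Type*} [TopologicalSpace N] [ChartedSpace H' N]
    [IsManifold J ∞ N] {𝓗 : Set (N → ℝ)} (h𝓗 : ContainsCoordinates J 𝓗)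
    {X : ∀ a : N, TangentSpace J a}
    (hX : ∀ h ∈ 𝓗, ContMDiff J 𝓘(ℝ, ℝ) ∞ fun a => (mfderiv J 𝓘(ℝ, ℝ) h a (X a) : ℝ))
    {α : ℝ → N} {S : Set ℝ} (hS : UniqueDiffOn ℝ S) (hα : IsMIntegralCurveOn (I := J) α X S) :
    ContMDiffOn 𝓘(ℝ, ℝ) J ∞ α S := by
  have hc (t) (ht : t ∈ S) : ContinuousWithinAt α S t := (hα t ht).1
  refine contMDiffOn_infty.2 fun n => ?_
  induction n with
  | zero => exact contMDiffOn_zero_iff.2 hc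
  | succ n ih =>
    refine fun t ht => h𝓗.contMDiffWithinAt_curve (hc t ht) fun h hh => ?_
    refine ContDiffOn.contDiffWithinAt (s := S) ?_ ht
    have hd (u) (hu : u ∈ S) := hasDerivWithinAt_comp_curve (h𝓗.contMDiff h hh) (hα u hu)
    suffices ContDiffOn ℝ ((n : ℕ∞ω) + 1) (h ∘ α) S by exact_mod_cast this
    -- `(h ∘ α)' = X(h) ∘ α`, and `X(h)` is a smooth function
    refine (contDiffOn_succ_iff_derivWithin hS).2
      ⟨fun u hu => (hd u hu).differentiableWithinAt, fun h0 => absurd h0 (by simp), ?_⟩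
    have h1 : ContMDiffOn 𝓘(ℝ, ℝ) 𝓘(ℝ, ℝ) n
        (fun u => (mfderiv J 𝓘(ℝ, ℝ) h (α u) (X (α u)) : ℝ)) S :=
      ((hX h hh).of_le (by exact_mod_cast le_top)).comp_contMDiffOn ih
    exact h1.contDiffOn.congr fun u hu => (hd u hu).derivWithin (hS u hu)

theorem LinearConnection.at_zero (D : LinearConnection L) (v : TotalSpace F A) : D.at v 0 = 0 := by
  have h := D.add_right (sectionThrough E v) 0 0
  rw [add_zero] at h
  have h1 := left_eq_add.1 h
  rw [LinearConnection.at, h1]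
  rfl

theorem isGeodesicOn_iff (hD : IsLeviCivita g D)
    {X : ∀ a : TotalSpace F A, TangentSpace (𝓘(ℝ, E).prod 𝓘(ℝ, F)) a}
    (hX : IsHamiltonianVectorField L g (energy g) X) {S : Set ℝ} (hS : UniqueDiffOn ℝ S)
    (α : ℝ → TotalSpace F A) :
    IsGeodesicOn D α S ↔ IsMIntegralCurveOn (I := 𝓘(ℝ, E).prod 𝓘(ℝ, F)) α X S := by
  have hXf (f : C^∞⟮𝓘(ℝ, E), M; 𝓘(ℝ, ℝ), ℝ⟯) (c : Sec E F A) (a : TotalSpace F A) :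
      (mfderiv (𝓘(ℝ, E).prod 𝓘(ℝ, F)) 𝓘(ℝ, ℝ) (affineFun g f c) a (X a) : ℝ) =
      dirDeriv f a.proj (L.anchor a.proj a.2) + g.inner a.proj a.2 (D.at a c) := by
    rw [hX.2 _ (contMDiff_affineFun g f c), metricBracket_energy_affineFun hD]
  constructor
  · rintro ⟨⟨hα, hp⟩, hgeo⟩ t ht
    refine (containsCoordinates_affineFun g).hasMFDerivWithinAt_curve
      (hα t ht).continuousWithinAt ?_
    rintro _ ⟨f, c, rfl⟩
    rw [hXf]
    have h1 := hasDerivWithinAt_pairing hD ht (hp t ht) (hgeo t ht) c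
    rw [map_zero, _root_.zero_apply, zero_add] at h1
    exact (hasDerivWithinAt_comp_curve f.contMDiff (hp t ht)).add h1
  · intro hα
    have hsm : ContMDiffOn 𝓘(ℝ, ℝ) (𝓘(ℝ, E).prod 𝓘(ℝ, F)) ∞ α S := by
      refine (containsCoordinates_affineFun g).contMDiffOn_of_isMIntegralCurveOn ?_ hS hα
      rintro _ ⟨f, c, rfl⟩
      simp only [hXf]
      exact (L.contMDiff_dirDeriv_anchor f.contMDiff).add (contMDiff_inner_at g _ c)
    have hd (t) (ht : t ∈ S) (f) (c) := hasDerivWithinAt_comp_curve (contMDiff_affineFun g f c)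
      (hα t ht)
    simp only [hXf] at hd
    have hpc (t) (ht : t ∈ S) : ContinuousWithinAt (fun u => (α u).proj) S t :=
      ((contMDiff_proj (IB := 𝓘(ℝ, E)) (n := ∞) A).continuous.continuousAt).comp_continuousWithinAt
        (hsm t ht).continuousWithinAt
    have hp (t) (ht : t ∈ S) : HasMFDerivWithinAt 𝓘(ℝ, ℝ) 𝓘(ℝ, E) (fun u => (α u).proj) S t
        ((1 : ℝ →L[ℝ] ℝ).smulRight (L.anchor (α t).proj (α t).2)) := by
      refine containsCoordinates_base.hasMFDerivWithinAt_curve (hpc t ht) fun f hf => ?_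
      -- functions pulled back from `M` give the velocity of the base path
      have h1 := hd t ht ⟨f, hf⟩ 0
      rw [D.at_zero, map_zero, add_zero] at h1
      refine h1.congr_of_eventuallyEq (Eventually.of_forall fun u => ?_) ?_
      all_goals
        change f _ = f _ + g.inner _ _ ((0 : Sec E F A) _)
        rw [ContMDiffSection.coe_zero, Pi.zero_apply, map_zero, add_zero]
    refine ⟨⟨hsm, hp⟩, fun t ht => ?_⟩
    obtain ⟨e, e', he⟩ := exists_dual_frames g (α t).proj
    have hcov : HasCovDerivAlong D S α α t _ := ⟨_, fun k => pairing g (e' k) ∘ α, e,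
      fun k => ((contMDiff_pairing g (e' k)).comp_contMDiffOn hsm).contDiffOn t ht,
      ((hpc t ht).eventually he).mono fun u hu =>
        congrArg (TotalSpace.mk (α u).proj) (hu (α u).2).1, rfl⟩
    -- the covariant derivative computed in the frame pairs to zero with every section
    convert hcov using 1
    refine inner_ext_sec (E := E) g fun c => ?_
    have h1 := hasDerivWithinAt_pairing hD ht (hp t ht) hcov c
    have h2 := hd t ht 0 c
    have h3 : affineFun g 0 c ∘ α = pairing g c ∘ α := by
      funext u
      exact zero_add _
    have h4 : dirDeriv (0 : C^∞⟮𝓘(ℝ, E), M; 𝓘(ℝ, ℝ), ℝ⟯) (α t).proj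
        (L.anchor (α t).proj (α t).2) = 0 := by
      have h5 : mfderiv 𝓘(ℝ, E) 𝓘(ℝ, ℝ) (fun _ : M => (0 : ℝ)) (α t).proj = 0 := mfderiv_const
      exact congrArg (fun φ => φ (L.anchor (α t).proj (α t).2)) h5
    rw [h3, h4] at h2
    rw [map_zero, _root_.zero_apply]
    exact add_right_cancel ((hS t ht).eq_deriv _ h2 h1)

end GeodesicFlow

end RiemLieAlgebroid

theorem theorem3p1
    {E : Type*} [NormedAddCommGroup E] [NormedSpace ℝ E] [FiniteDimensional ℝ E]
    {M : Type*} [TopologicalSpace M] [ChartedSpace E M] [IsManifold 𝓘(ℝ, E) ∞ M] [T2Space M]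
    {F : Type*} [NormedAddCommGroup F] [NormedSpace ℝ F] [FiniteDimensional ℝ F]
    {A : M → Type*} [TopologicalSpace (TotalSpace F A)] [∀ x, AddCommGroup (A x)]
    [∀ x, Module ℝ (A x)] [∀ x, TopologicalSpace (A x)]
    [∀ x, IsTopologicalAddGroup (A x)] [∀ x, ContinuousSMul ℝ (A x)]
    [FiberBundle F A] [VectorBundle ℝ F A] [ContMDiffVectorBundle ∞ F A 𝓘(ℝ, E)]
    (L : RiemLieAlgebroid.LieAlgebroid E F A) (g : RiemLieAlgebroid.Metric E F A) :
    (∃! D : RiemLieAlgebroid.LinearConnection L, RiemLieAlgebroid.IsLeviCivita g D) ∧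
    (∃! X : ∀ a : TotalSpace F A, TangentSpace (𝓘(ℝ, E).prod 𝓘(ℝ, F)) a,
      RiemLieAlgebroid.IsHamiltonianVectorField L g (RiemLieAlgebroid.energy g) X) ∧
    ∀ (D : RiemLieAlgebroid.LinearConnection L)
      (X : ∀ a : TotalSpace F A, TangentSpace (𝓘(ℝ, E).prod 𝓘(ℝ, F)) a),
      RiemLieAlgebroid.IsLeviCivita g D →
      RiemLieAlgebroid.IsHamiltonianVectorField L g (RiemLieAlgebroid.energy g) X →
      ∀ S : Set ℝ, S.OrdConnected → S.Nontrivial → ∀ α : ℝ → TotalSpace F A,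
        (RiemLieAlgebroid.IsGeodesicOn D α S ↔
          IsMIntegralCurveOn (I := 𝓘(ℝ, E).prod 𝓘(ℝ, F)) α X S) := by
  refine ⟨RiemLieAlgebroid.existsUnique_leviCivita L g,
    RiemLieAlgebroid.existsUnique_hamiltonianVectorField L g, fun D X hD hX S hS hS' α => ?_⟩
  exact RiemLieAlgebroid.isGeodesicOn_iff hD hX
    (RiemLieAlgebroid.uniqueDiffOn_of_ordConnected hS hS') α
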